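/- **Setting.** Let $1\le b\le n$ be integers, $L>0$, and let $f_1,\dots,f_n:\mathbb R^m\to\mathbb R$ be convex and differentiable with $L$-Lipschitz gradients. Let $g:\mathbb R^m\to\mathbb R\cup\{\infty\}$ be proper, lower semicontinuous and convex. Put $f=\frac1n\sum_{i=1}^n f_i$ and $F=f+g$, let $x^*$ be a minimiser of $F$, and let $x_0$ be a point with $F(x_0)<\infty$. Let $J_0,J_1,\dots$ be independent random sets, each uniformly distributed over the subsets of $\{1,\dots,n\}$ with $b$ elements. **Algorithm (accelerated SARGE).** Given step sizes $\gamma_k$ and momentum parameters $\tau_k$, start from $y_0=z_0=x_0$, $\widetilde\nabla_0=\nabla f(x_0)$, $\psi_0^i=\frac bn\nabla f_i(x_0)$ for all $i$, and for $k=0,1,2,\dots$ set $$x_{k+1}=\tau_k z_k+(1-\tau_k)y_k,$$ $$\widetilde\nabla_{k+1}=\frac1b\sum_{j\in J_k}\bigl(\nabla f_j(x_{k+1})-\psi_k^j\bigr)+\frac1n\sum_{i=1}^n\psi_k^i-\Bigl(1-\frac bn\Bigr)\Bigl(\frac1b\sum_{j\in J_k}\nabla f_j(x_k)-\widetilde\nabla_k\Bigr),$$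 $$\psi_{k+1}^j=\nabla f_j(x_{k+1})-\Bigl(1-\frac bn\Bigr)\nabla f_j(x_k)\ \ (j\in J_k),\qquad \psi_{k+1}^i=\psi_k^i\ \ (i\notin J_k),$$ $$z_{k+1}=\operatorname{argmin}_{w}\Bigl\{\tfrac12\bigl\|w-(z_k-\gamma_k\widetilde\nabla_{k+1})\bigr\|^2+\gamma_k g(w)\Bigr\},\qquad y_{k+1}=\tau_k z_{k+1}+(1-\tau_k)y_k.$$ **Theorem.** Let $c=86016\,n^4/b^4$. 1. With $\gamma_k=\dfrac{k+\frac{4n}b+4}{2cL}$ and $\tau_k=\dfrac1{cL\gamma_k}$, for every $T\ge1$, $$\mathbb E F(y_T)-F(x^*)\le\frac{\bigl(\frac{4n}b+2\bigr)\bigl(\frac{4n}b+4\bigr)K_1}{\bigl(T+\frac{4n}b+3\bigr)^2},\qquad K_1=F(x_0)-F(x^*)+\frac{2cL}{\bigl(\frac{4n}b+2\bigr)\bigl(\frac{4n}b+4\bigr)}\|x_0-x^*\|^2 .$$ 2. If moreover $g$ is $\mu$-strongly convex with $\mu>0$, then with the constant parameters $\gamma_k=\gamma=\min\bigl\{\frac1{\sqrt{c\mu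 L}},\frac b{4n\mu}\bigr\}$ and $\tau_k=\tau=\mu\gamma$, for every $T\ge0$, $$\mathbb E\|z_T-x^*\|^2\le\Bigl(1+\min\Bigl\{\sqrt{\frac{\mu}{cL}},\frac b{4n}\Bigr\}\Bigr)^{-T}K_2,\qquad K_2=\frac2\mu\bigl(F(x_0)-F(x^*)\bigr)+\|x_0-x^*\|^2,$$ where $\sqrt{\mu/(cL)}=\dfrac{b^2\sqrt\mu}{64\sqrt{21}\,n^2\sqrt L}$. -/

import Mathlib

open MeasureTheory ProbabilityTheory
open scoped NNReal ENNReal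

noncomputable section

namespace Sarge

/-- The ambient space `ℝᵐ` with its Euclidean norm. -/
abbrev E (m : ℕ) : Type := EuclideanSpace ℝ (Fin m)

/-- The effective domain of an extended-real-valued function. -/
def effDom {m : ℕ} (g : E m → EReal) : Set (E m) := {x | g x ≠ ⊤}

/-- `g` takes values in `ℝ ∪ {∞}` and is not identically `∞`. -/
def Proper {m : ℕ} (g : E m → EReal) : Prop :=
  (∀ x, g x ≠ ⊥) ∧ ∃ x, g x ≠ ⊤

/-- Strong convexity with modulus `μ` of a function `g : ℝᵐ → ℝ ∪ {∞}`: its effective domain is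
convex and `g` is `μ`-strongly convex there. For `μ = 0` this is convexity. -/
def StronglyConvex {m : ℕ} (μ : ℝ) (g : E m → EReal) : Prop :=
  StrongConvexOn (effDom g) μ (fun x => (g x).toReal)

/-- The smooth part `f = (1/n) ∑ᵢ fᵢ`. -/
def smooth {m n : ℕ} (f : Fin n → E m → ℝ) (x : E m) : ℝ :=
  (1 / (n : ℝ)) * ∑ i, f i x

/-- The objective `F = f + g`. -/
def obj {m n : ℕ} (f : Fin n → E m → ℝ) (g : E m → EReal) (x : E m) : EReal :=
  ((smooth f x : ℝ) : EReal) + g x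

/-- `z` minimises `w ↦ ½ ‖w - v‖² + γ g(w)`. -/
def IsProx {m : ℕ} (g : E m → EReal) (γ : ℝ) (v z : E m) : Prop :=
  ∀ w : E m, (((1 / 2 : ℝ) * ‖z - v‖ ^ 2 : ℝ) : EReal) + (γ : EReal) * g z ≤
    (((1 / 2 : ℝ) * ‖w - v‖ ^ 2 : ℝ) : EReal) + (γ : EReal) * g w

/-- The proximal operator `prox_{γ g}(v) = argmin_w { ½ ‖w - v‖² + γ g(w) }`. The minimiser exists
and is unique when `γ > 0` and `g` is proper, lower semicontinuous and convex. -/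
def prox {m : ℕ} (g : E m → EReal) (γ : ℝ) (v : E m) : E m :=
  Classical.epsilon (IsProx g γ v)

/-- The variables of the accelerated SARGE method at iteration `k`: the points `xₖ, yₖ, zₖ`, the
gradient estimate at `xₖ`, and the table `ψₖ¹, …, ψₖⁿ`. -/
structure State (m n : ℕ) where
  x : E m
  y : E m
  z : E m
  est : E m
  ψ : Fin n → E m

/-- Initialisation at `x₀ = y₀ = z₀`, with the exact gradient of `f` at `x₀` and the table entries
that the update rule gives when all previous points are equal to `x₀`:
`∇fᵢ(x₀) - (1 - b/n) ∇fᵢ(x₀) = (b/n) ∇fᵢ(x₀)`. -/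
def init {m n : ℕ} (f : Fin n → E m → ℝ) (b : ℕ) (x₀ : E m) : State m n where
  x := x₀
  y := x₀
  z := x₀
  est := (1 / (n : ℝ)) • ∑ i, gradient (f i) x₀
  ψ := fun i => gradient (f i) x₀ - (1 - (b : ℝ) / n) • gradient (f i) x₀

/-- The SARGE estimate of the gradient of `f` at `x'`, from the previous state and the batch. -/
def estimate {m n : ℕ} (f : Fin n → E m → ℝ) (b : ℕ) (J : Finset (Fin n)) (s : State m n)
    (x' : E m) : E m :=
  (1 / (b : ℝ)) • (∑ j ∈ J, (gradient (f j) x' - s.ψ j)) + (1 / (n : ℝ)) • (∑ i, s.ψ i)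
    - (1 - (b : ℝ) / n) • ((1 / (b : ℝ)) • (∑ j ∈ J, gradient (f j) s.x) - s.est)

/-- One iteration with step size `γ`, momentum parameter `τ` and batch `J`. -/
def step {m n : ℕ} (f : Fin n → E m → ℝ) (g : E m → EReal) (b : ℕ) (γ τ : ℝ)
    (J : Finset (Fin n)) (s : State m n) : State m n :=
  let x' : E m := τ • s.z + (1 - τ) • s.y
  let est' : E m := estimate f b J s x'
  let z' : E m := prox g γ (s.z - γ • est')
  { x := x'
    y := τ • z' + (1 - τ) • s.y
    z := z'
    est := est'
    ψ := fun i =>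
      if i ∈ J then gradient (f i) x' - (1 - (b : ℝ) / n) • gradient (f i) s.x else s.ψ i }

/-- The state after `k` iterations, along the sequence of batches `J 0, J 1, …`. -/
def iter {m n : ℕ} (f : Fin n → E m → ℝ) (g : E m → EReal) (b : ℕ) (γ τ : ℕ → ℝ) (x₀ : E m)
    (J : ℕ → Finset (Fin n)) : ℕ → State m n
  | 0 => init f b x₀
  | k + 1 => step f g b (γ k) (τ k) (J k) (iter f g b γ τ x₀ J k)

/-- `J 0, J 1, …` are independent random batches, each uniformly distributed over the subsets of
`{1, …, n}` with `b` elements. -/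
structure IsUniformBatches {Ω : Type*} [MeasurableSpace Ω] (P : Measure Ω) (n b : ℕ)
    (J : ℕ → Ω → Finset (Fin n)) : Prop where
  measurable : ∀ k S, MeasurableSet {ω | J k ω = S}
  indep : iIndepFun (m := fun _ => (⊤ : MeasurableSpace (Finset (Fin n)))) J P
  uniform : ∀ k S, S.card = b → P {ω | J k ω = S} = ((n.choose b : ℕ) : ℝ≥0∞)⁻¹

/-- The constant `c = 86016 n⁴ / b⁴`. -/
def c (n b : ℕ) : ℝ := 86016 * (n : ℝ) ^ 4 / (b : ℝ) ^ 4

/-- The step sizes `γₖ = (k + 4n/b + 4) / (2 c L)`. -/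
def stepSize (n b : ℕ) (L : ℝ) (k : ℕ) : ℝ :=
  ((k : ℝ) + 4 * n / b + 4) / (2 * c n b * L)

/-- The momentum parameters `τₖ = 1 / (c L γₖ)`. -/
def momentum (n b : ℕ) (L : ℝ) (k : ℕ) : ℝ :=
  1 / (c n b * L * stepSize n b L k)

/-- The constant step size `γ = min {1 / √(c μ L), b / (4 n μ)}` of the strongly convex case. -/
def stepSizeSC (n b : ℕ) (L μ : ℝ) : ℝ :=
  min (1 / √(c n b * μ * L)) ((b : ℝ) / (4 * n * μ))

/-- The constant momentum parameter `τ = μ γ` of the strongly convex case. -/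
def momentumSC (n b : ℕ) (L μ : ℝ) : ℝ := μ * stepSizeSC n b L μ

end Sarge

end

/-! Write ρ = b/n, and let e be the error of the gradient estimate. The estimator is biased, but
only through its past: given the history, the mean of the new error is (1 - ρ)e, and its second
moment is bounded by (1 - ρ)²‖e‖² plus the mean squared gradient change and the table error
(`estErr_step`, `batchMean_norm_estErr_sq_le`). The table error itself contracts by 1 - 3ρ/4, up to
the same gradient change (`batchMean_tableErrSq_le`).

The deterministic inequality `IsProblem.descent` is the usual accelerated proximal estimate plus the
term -γ⟨e', z' - x*⟩. Its part along z' - z is absorbed by Young's inequality. Its part along z - x*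
averages to a multiple of (1 - ρ)⟨e, z - x*⟩, which has no sign, so it is carried in the Lyapunov
function with a weight h obeying the backward recursion h = γ + λ(1 - ρ)h'. This geometric sum stays
below 4γ/(3ρ) as long as λγ' ≤ (1 + ρ/4)γ. The weight depends on the remaining horizon, so the
argument runs backwards from T, where h = 0.

The gradient change is paid for by the Bregman term that descent leaves over and by ‖y - x‖² = τ²‖z'
- z‖² from the preceding step; this is where cLγτ ≤ 1 with c of order ρ⁻⁴ enters. At initialisation
all error terms vanish. Both rates follow from `IsProblem.pow_mul_integral_le`: λ = 1 with growing
steps, and λ = 1 + μγ with constant steps. -/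

namespace Sarge

/-! ### Smooth convex functions. -/

section ConvexAnalysis

variable {H : Type*} [NormedAddCommGroup H] [InnerProductSpace ℝ H] [CompleteSpace H]

lemma hasDerivAt_comp_line {f : H → ℝ} (hf : Differentiable ℝ f) (x d : H) (t : ℝ) :
    HasDerivAt (fun t : ℝ => f (x + t • d)) (inner ℝ (gradient f (x + t • d)) d) t := by
  have h1 : HasDerivAt (fun t : ℝ => x + t • d) d t := by
    simpa using ((hasDerivAt_id t).smul_const d).const_add x
  have h2 := (hf (x + t • d)).hasFDerivAt.comp_hasDerivAt t h1
  rwa [← inner_gradient_left] at h2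

lemma le_quadratic_of_lipschitzWith_gradient {f : H → ℝ} {L : ℝ≥0} (hf : Differentiable ℝ f)
    (hL : LipschitzWith L (gradient f)) (x y : H) :
    f y ≤ f x + inner ℝ (gradient f x) (y - x) + L / 2 * ‖y - x‖ ^ 2 := by
  set d := y - x
  let φ : ℝ → ℝ := fun t => f (x + t • d) - t * inner ℝ (gradient f x) d - L / 2 * t ^ 2 * ‖d‖ ^ 2
  have hφ : ∀ t, HasDerivAt φ (inner ℝ (gradient f (x + t • d)) d - inner ℝ (gradient f x) d
      - L * t * ‖d‖ ^ 2) t := by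
    intro t
    have h := ((hasDerivAt_comp_line hf x d t).sub
      ((hasDerivAt_id t).mul_const (inner ℝ (gradient f x) d))).sub
      ((((hasDerivAt_id t).pow 2).const_mul ((L : ℝ) / 2)).mul_const (‖d‖ ^ 2))
    refine h.congr_deriv ?_
    simp only [id]
    push_cast
    ring
  have hanti : AntitoneOn φ (Set.Icc 0 1) := by
    refine antitoneOn_of_deriv_nonpos (convex_Icc 0 1)
      (fun t _ => (hφ t).continuousAt.continuousWithinAt)
      (fun t _ => (hφ t).differentiableAt.differentiableWithinAt) fun t ht => ?_
    rw [interior_Icc] at ht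
    rw [(hφ t).deriv, ← inner_sub_left]
    have h1 := real_inner_le_norm (gradient f (x + t • d) - gradient f x) d
    have h2 := hL.dist_le_mul (x + t • d) x
    rw [dist_eq_norm, dist_eq_norm, add_sub_cancel_left, norm_smul, Real.norm_eq_abs,
      abs_of_pos ht.1] at h2
    nlinarith [norm_nonneg d, mul_le_mul_of_nonneg_right h2 (norm_nonneg d)]
  have h := hanti (Set.left_mem_Icc.2 zero_le_one) (Set.right_mem_Icc.2 zero_le_one) zero_le_one
  simp only [φ, d, one_smul, zero_smul, add_sub_cancel, add_zero] at h
  simp only [d]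
  linarith

/-- A real number that dominates a linear function near `0⁺` dominates its slope. -/
lemma le_of_forall_mul_le_mul_add_sq {a b C : ℝ}
    (h : ∀ t : ℝ, 0 < t → t ≤ 1 → t * a ≤ t * b + C * t ^ 2) : a ≤ b := by
  refine le_of_forall_pos_le_add fun ε hε => ?_
  have hC : 0 < |C| + 1 := by positivity
  set t := min 1 (ε / (|C| + 1)) with ht
  have ht0 : 0 < t := lt_min one_pos (by positivity)
  have h1 := h t ht0 (min_le_left _ _)
  have h2 : t * (|C| + 1) ≤ ε := by
    have := min_le_right 1 (ε / (|C| + 1))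
    rwa [← ht, le_div_iff₀ hC] at this
  have h3 : t * a ≤ t * (b + C * t) := by linarith
  have h4 := le_of_mul_le_mul_left h3 ht0
  nlinarith [le_abs_self C]

lemma add_inner_gradient_le {f : H → ℝ} (hc : ConvexOn ℝ Set.univ f) (hf : Differentiable ℝ f)
    (x y : H) : f x + inner ℝ (gradient f x) (y - x) ≤ f y := by
  have hd := hasDerivAt_comp_line hf x (y - x) 0
  have hcv : ConvexOn ℝ Set.univ (fun t : ℝ => f (x + t • (y - x))) := by
    refine ⟨convex_univ, fun s _ t _ a b ha hb hab => ?_⟩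
    have := hc.2 (Set.mem_univ (x + s • (y - x))) (Set.mem_univ (x + t • (y - x))) ha hb hab
    convert this using 2
    have hx : x = a • x + b • x := by rw [← add_smul, hab, one_smul]
    nth_rewrite 1 [hx]
    simp only [smul_eq_mul]
    module
  have := hcv.le_slope_of_hasDerivAt (Set.mem_univ 0) (Set.mem_univ 1) one_pos hd
  simp only [zero_smul, add_zero, slope_def_field, one_smul, add_sub_cancel, sub_zero,
    div_one] at this
  linarith

/-- Compare two bounds for f at w, one gradient step of length 1/L from y for the function f -
⟨∇f(x), ·⟩: convexity at x bounds f(w) below, the quadratic bound at y bounds it above. -/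
lemma norm_gradient_sub_sq_le {f : H → ℝ} {L : ℝ≥0} (hL0 : 0 < L)
    (hc : ConvexOn ℝ Set.univ f) (hf : Differentiable ℝ f)
    (hL : LipschitzWith L (gradient f)) (x y : H) :
    ‖gradient f x - gradient f y‖ ^ 2 ≤
      2 * L * (f y - f x - inner ℝ (gradient f x) (y - x)) := by
  have hLp : (0 : ℝ) < L := hL0
  set G := gradient f x - gradient f y with hG
  set w := y + (1 / (L : ℝ)) • G with hw
  have h1 := add_inner_gradient_le hc hf x w
  have h2 := le_quadratic_of_lipschitzWith_gradient hf hL y w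
  have hwy : w - y = (1 / (L : ℝ)) • G := by simp [hw]
  have hwx : w - x = (y - x) + (1 / (L : ℝ)) • G := by rw [hw]; abel
  rw [hwx, inner_add_right, inner_smul_right] at h1
  rw [hwy, inner_smul_right, norm_smul, Real.norm_eq_abs, abs_of_pos (by positivity)] at h2
  have h3 : inner ℝ (gradient f x) G - inner ℝ (gradient f y) G = ‖G‖ ^ 2 := by
    rw [← inner_sub_left, ← hG, real_inner_self_eq_norm_sq]
  have h4 : 1 / (L : ℝ) * ‖G‖ ^ 2 - L / 2 * (1 / L * ‖G‖) ^ 2 = ‖G‖ ^ 2 / (2 * L) := by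
    field_simp; ring
  have h5 : ‖G‖ ^ 2 / (2 * L) ≤ f y - f x - inner ℝ (gradient f x) (y - x) := by
    rw [← h4, ← h3]; linarith
  rw [div_le_iff₀ (by positivity)] at h5
  linarith

end ConvexAnalysis

/-- The standing assumptions on a composite problem `min f + g` with minimiser `xstar`. -/
structure IsProblem {m n : ℕ} (f : Fin n → E m → ℝ) (g : E m → EReal) (L : ℝ≥0)
    (xstar : E m) : Prop where
  n_pos : 0 < n
  L_pos : 0 < L
  convex : ∀ i, ConvexOn ℝ Set.univ (f i)
  diff : ∀ i, Differentiable ℝ (f i)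
  lip : ∀ i, LipschitzWith L (gradient (f i))
  proper : Proper g
  lsc : LowerSemicontinuous g
  gconvex : StronglyConvex 0 g
  isMin : ∀ x, obj f g xstar ≤ obj f g x

/-- The objective as a real-valued function, meaningful on the effective domain. -/
noncomputable def realObj {m n : ℕ} (f : Fin n → E m → ℝ) (g : E m → EReal) (x : E m) : ℝ :=
  smooth f x + (g x).toReal

/-- The mean of the component gradients, that is, the gradient of `smooth f`. -/
noncomputable def meanGrad {m n : ℕ} (f : Fin n → E m → ℝ) (x : E m) : E m :=
  (1 / (n : ℝ)) • ∑ i, gradient (f i) x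

/-! ### The composite problem and its proximal operator. -/

section Problem

variable {m n : ℕ} {f : Fin n → E m → ℝ} {g : E m → EReal} {L : ℝ≥0} {xstar : E m}

lemma IsProblem.coe_toReal (hp : IsProblem f g L xstar) {x : E m} (hx : x ∈ effDom g) :
    ((g x).toReal : EReal) = g x :=
  EReal.coe_toReal hx (hp.proper.1 x)

lemma IsProblem.obj_eq (hp : IsProblem f g L xstar) {x : E m} (hx : x ∈ effDom g) :
    obj f g x = (realObj f g x : EReal) := by
  rw [obj, realObj, EReal.coe_add, hp.coe_toReal hx]

lemma obj_ne_top_iff {x : E m} : obj f g x ≠ ⊤ ↔ x ∈ effDom g := by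
  simp only [obj, effDom, Set.mem_ofPred_eq, ne_eq]
  refine not_congr ⟨fun h => ?_, fun h => by simp [h]⟩
  by_contra hg
  exact EReal.add_ne_top (EReal.coe_ne_top _) hg h

lemma IsProblem.xstar_mem (hp : IsProblem f g L xstar) : xstar ∈ effDom g := by
  obtain ⟨x, hx⟩ := hp.proper.2
  exact obj_ne_top_iff.1
    (ne_top_of_le_ne_top (obj_ne_top_iff (f := f).2 (show x ∈ effDom g from hx)) (hp.isMin x))

lemma IsProblem.realObj_le (hp : IsProblem f g L xstar) {x : E m} (hx : x ∈ effDom g) :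
    realObj f g xstar ≤ realObj f g x := by
  have h := hp.isMin x
  rwa [hp.obj_eq hx, hp.obj_eq hp.xstar_mem, EReal.coe_le_coe_iff] at h

lemma IsProblem.combo_mem (hp : IsProblem f g L xstar) {x y : E m} (hx : x ∈ effDom g)
    (hy : y ∈ effDom g) {t : ℝ} (h0 : 0 ≤ t) (h1 : t ≤ 1) :
    t • x + (1 - t) • y ∈ effDom g :=
  hp.gconvex.1 hx hy h0 (by linarith) (by ring)

lemma IsProblem.combo_le (hp : IsProblem f g L xstar) {x y : E m} (hx : x ∈ effDom g)
    (hy : y ∈ effDom g) {t : ℝ} (h0 : 0 ≤ t) (h1 : t ≤ 1) :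
    (g (t • x + (1 - t) • y)).toReal ≤ t * (g x).toReal + (1 - t) * (g y).toReal := by
  have h := hp.gconvex.2 hx hy h0 (sub_nonneg.2 h1) (by ring)
  simpa using h

lemma IsProblem.smooth_le (hp : IsProblem f g L xstar) (x y : E m) :
    smooth f y ≤ smooth f x + inner ℝ (meanGrad f x) (y - x) + L / 2 * ‖y - x‖ ^ 2 := by
  have hn : (0 : ℝ) < n := Nat.cast_pos.2 hp.n_pos
  have h : ∑ i, f i y ≤ ∑ i, (f i x + inner ℝ (gradient (f i) x) (y - x)
      + L / 2 * ‖y - x‖ ^ 2) :=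
    Finset.sum_le_sum fun i _ => le_quadratic_of_lipschitzWith_gradient (hp.diff i) (hp.lip i) x y
  rw [Finset.sum_add_distrib, Finset.sum_add_distrib, ← sum_inner, Finset.sum_const,
    Finset.card_univ, Fintype.card_fin, nsmul_eq_mul] at h
  have h' := mul_le_mul_of_nonneg_left h (by positivity : 0 ≤ 1 / (n : ℝ))
  rw [smooth, smooth, meanGrad, inner_smul_left]
  refine h'.trans_eq ?_
  simp
  field_simp

lemma IsProblem.add_inner_meanGrad_le (hp : IsProblem f g L xstar) (x y : E m) :
    smooth f x + inner ℝ (meanGrad f x) (y - x) ≤ smooth f y := by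
  have h : ∑ i, (f i x + inner ℝ (gradient (f i) x) (y - x)) ≤ ∑ i, f i y :=
    Finset.sum_le_sum fun i _ => add_inner_gradient_le (hp.convex i) (hp.diff i) x y
  rw [Finset.sum_add_distrib, ← sum_inner] at h
  have h' := mul_le_mul_of_nonneg_left h (by positivity : 0 ≤ 1 / (n : ℝ))
  rw [smooth, smooth, meanGrad, inner_smul_left]
  refine le_trans (le_of_eq ?_) h'
  simp
  ring

/-- The mean squared gradient difference is controlled by the Bregman divergence. -/
lemma IsProblem.mean_norm_gradient_sub_sq_le (hp : IsProblem f g L xstar) (x y : E m) :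
    1 / (n : ℝ) * ∑ i, ‖gradient (f i) x - gradient (f i) y‖ ^ 2 ≤
      2 * L * (smooth f y - smooth f x - inner ℝ (meanGrad f x) (y - x)) := by
  have h : ∑ i, ‖gradient (f i) x - gradient (f i) y‖ ^ 2 ≤
      ∑ i, 2 * L * (f i y - f i x - inner ℝ (gradient (f i) x) (y - x)) :=
    Finset.sum_le_sum fun i _ =>
      norm_gradient_sub_sq_le hp.L_pos (hp.convex i) (hp.diff i) (hp.lip i) x y
  rw [← Finset.mul_sum, Finset.sum_sub_distrib, Finset.sum_sub_distrib, ← sum_inner] at h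
  have h' := mul_le_mul_of_nonneg_left h (by positivity : 0 ≤ 1 / (n : ℝ))
  rw [smooth, smooth, meanGrad, inner_smul_left]
  refine h'.trans_eq ?_
  simp
  ring

/-- Optimality of `xstar` gives an affine minorant of `g`. -/
lemma IsProblem.affine_minorant (hp : IsProblem f g L xstar) {w : E m} (hw : w ∈ effDom g) :
    (g xstar).toReal - inner ℝ (meanGrad f xstar) (w - xstar) ≤ (g w).toReal := by
  suffices h : (g xstar).toReal - (g w).toReal ≤ inner ℝ (meanGrad f xstar) (w - xstar) by
    linarith
  refine le_of_forall_mul_le_mul_add_sq (C := L / 2 * ‖w - xstar‖ ^ 2) fun t h0 h1 => ?_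
  have h2 := hp.realObj_le (hp.combo_mem hw hp.xstar_mem h0.le h1)
  have h3 := hp.combo_le hw hp.xstar_mem h0.le h1
  have h4 := hp.smooth_le xstar (t • w + (1 - t) • xstar)
  have h5 : t • w + (1 - t) • xstar - xstar = t • (w - xstar) := by module
  rw [h5, inner_smul_right, norm_smul, mul_pow, Real.norm_eq_abs, sq_abs] at h4
  simp only [realObj] at h2
  linarith

/-- A lower semicontinuous function attains its minimum on a compact ball; the affine minorant of g
shows that points outside the ball do no better than `xstar`. -/
lemma IsProblem.exists_isProx (hp : IsProblem f g L xstar) {γ : ℝ} (hγ : 0 < γ) (v : E m) :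
    ∃ z, IsProx g γ v z := by
  let q : E m → EReal := fun w =>
    (((1 / 2 : ℝ) * ‖w - v‖ ^ 2 : ℝ) : EReal) + (γ : EReal) * g w
  have hreal : ∀ w ∈ effDom g,
      q w = ((1 / 2 * ‖w - v‖ ^ 2 + γ * (g w).toReal : ℝ) : EReal) := fun w hw => by
    rw [EReal.coe_add, EReal.coe_mul γ, hp.coe_toReal hw]
  have htop : ∀ w, w ∉ effDom g → q w = ⊤ := fun w hw => by
    have : g w = ⊤ := by simpa [effDom] using hw
    simp only [q, this, EReal.coe_mul_top_of_pos hγ, EReal.coe_add_top]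
  have hmul : Continuous fun a : EReal => (γ : EReal) * a := by
    refine continuous_iff_continuousAt.2 fun a => ?_
    have h := EReal.continuousAt_mul (p := ((γ : EReal), a)) (by simp [hγ.ne']) (by simp [hγ.ne'])
      (by simp) (by simp)
    exact ContinuousAt.comp (f := fun a : EReal => ((γ : EReal), a)) h
      (Continuous.prodMk_right _).continuousAt
  have hmono : Monotone fun a : EReal => (γ : EReal) * a := fun a b hab =>
    mul_le_mul_of_nonneg_left hab (EReal.coe_nonneg.2 hγ.le)
  have hlsc : LowerSemicontinuous q := by
    have h1 : Continuous fun w : E m => (((1 / 2 : ℝ) * ‖w - v‖ ^ 2 : ℝ) : EReal) :=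
      continuous_coe_real_ereal.comp (by fun_prop)
    exact h1.lowerSemicontinuous.add' (hmul.comp_lowerSemicontinuous hp.lsc hmono) fun w =>
      EReal.continuousAt_add (.inl (EReal.coe_ne_top _)) (.inl (EReal.coe_ne_bot _))
  set G := meanGrad f xstar
  -- With p = ‖w - v‖ and q = ‖xstar - v‖, the objective at w exceeds that at `xstar` by at least
  -- ½(p + q)(p - q - 2γ‖G‖), which is nonnegative once p ≥ R.
  set R : ℝ := ‖xstar - v‖ + 2 * γ * ‖G‖ with hR
  have hRv : ‖xstar - v‖ ≤ R := le_add_of_nonneg_right (by positivity)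
  obtain ⟨z, hz, hmin⟩ := LowerSemicontinuousOn.exists_isMinOn
    (s := Metric.closedBall v R) ⟨xstar, by simpa [dist_eq_norm] using hRv⟩
    (isCompact_closedBall v R) (hlsc.lowerSemicontinuousOn _)
  refine ⟨z, fun w => ?_⟩
  change q z ≤ q w
  by_cases hwR : w ∈ Metric.closedBall v R
  · exact hmin hwR
  refine (hmin (show xstar ∈ Metric.closedBall v R by simpa [dist_eq_norm] using hRv)).trans ?_
  by_cases hw : w ∈ effDom g
  swap
  · simp [htop w hw]
  rw [hreal w hw, hreal xstar hp.xstar_mem, EReal.coe_le_coe_iff]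
  have h1 : R < ‖w - v‖ := by simpa [dist_eq_norm] using hwR
  have h2 := hp.affine_minorant hw
  have h3 : inner ℝ G (w - xstar) ≤ ‖G‖ * (‖w - v‖ + ‖xstar - v‖) :=
    (real_inner_le_norm _ _).trans (mul_le_mul_of_nonneg_left
      ((norm_sub_le_norm_sub_add_norm_sub w v xstar).trans_eq (by rw [norm_sub_rev v xstar]))
      (norm_nonneg _))
  have h4 := mul_le_mul_of_nonneg_left (h2.trans' (sub_le_sub_left h3 _)) hγ.le
  have h5 : 0 ≤ (‖w - v‖ - ‖xstar - v‖ - 2 * γ * ‖G‖) * (‖w - v‖ + ‖xstar - v‖) :=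
    mul_nonneg (by linarith) (by positivity)
  nlinarith

lemma IsProblem.isProx_prox (hp : IsProblem f g L xstar) {γ : ℝ} (hγ : 0 < γ) (v : E m) :
    IsProx g γ v (prox g γ v) :=
  Classical.epsilon_spec (hp.exists_isProx hγ v)

lemma IsProblem.prox_mem (hp : IsProblem f g L xstar) {γ : ℝ} (hγ : 0 < γ) (v : E m) :
    prox g γ v ∈ effDom g := fun htop => by
  have h := hp.isProx_prox hγ v xstar
  rw [htop, EReal.coe_mul_top_of_pos hγ, EReal.coe_add_top, ← hp.coe_toReal hp.xstar_mem,
    ← EReal.coe_mul, ← EReal.coe_add, top_le_iff] at h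
  exact EReal.coe_ne_top _ h

/-- The variational inequality of the proximal point, with the gain from strong convexity. -/
lemma IsProblem.prox_le (hp : IsProblem f g L xstar) {μ : ℝ} (hg : StronglyConvex μ g) {γ : ℝ}
    (hγ : 0 < γ) (v : E m) {w : E m} (hw : w ∈ effDom g) :
    γ * (g (prox g γ v)).toReal + γ * μ / 2 * ‖w - prox g γ v‖ ^ 2 ≤
      γ * (g w).toReal + inner ℝ (prox g γ v - v) (w - prox g γ v) := by
  set z := prox g γ v
  have hz : z ∈ effDom g := hp.prox_mem hγ v
  suffices h : γ * (g z).toReal - γ * (g w).toReal + γ * μ / 2 * ‖w - z‖ ^ 2 ≤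
      inner ℝ (z - v) (w - z) by linarith
  -- First-order optimality along the segment from z to w. The quadratic remainder collects the
  -- expanded square and the t² part of the strong convexity gain t(1 - t).
  refine le_of_forall_mul_le_mul_add_sq
    (C := 1 / 2 * ‖w - z‖ ^ 2 + γ * μ / 2 * ‖w - z‖ ^ 2) fun t h0 h1 => ?_
  have h2 := hp.isProx_prox hγ v (t • w + (1 - t) • z)
  have h3 := hg.2 hw hz h0.le (sub_nonneg.2 h1) (by ring)
  have hm := hp.combo_mem hw hz h0.le h1
  rw [← hp.coe_toReal hz, ← hp.coe_toReal hm, ← EReal.coe_mul, ← EReal.coe_add, ← EReal.coe_mul,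
    ← EReal.coe_add, EReal.coe_le_coe_iff] at h2
  have h5 : t • w + (1 - t) • z - v = (z - v) + t • (w - z) := by module
  rw [h5, norm_add_sq_real, inner_smul_right, norm_smul, mul_pow, Real.norm_eq_abs, sq_abs] at h2
  simp only [smul_eq_mul] at h3
  have h6 := mul_le_mul_of_nonneg_left h3 hγ.le
  linarith

end Problem

/-- The mean of `φ` over all batches of size `b`. -/
noncomputable def batchMean (n b : ℕ) (φ : Finset (Fin n) → ℝ) : ℝ :=
  ((n.choose b : ℕ) : ℝ)⁻¹ * ∑ S ∈ Finset.powersetCard b Finset.univ, φ S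

/-! ### Averages over uniform batches. -/

section BatchMean

variable {n b : ℕ}

lemma batchMean_add (φ χ : Finset (Fin n) → ℝ) :
    batchMean n b (fun S => φ S + χ S) = batchMean n b φ + batchMean n b χ := by
  simp only [batchMean, Finset.sum_add_distrib, mul_add]

lemma batchMean_const_mul (a : ℝ) (φ : Finset (Fin n) → ℝ) :
    batchMean n b (fun S => a * φ S) = a * batchMean n b φ := by
  simp only [batchMean, ← Finset.mul_sum]
  ring

lemma batchMean_const (hbn : b ≤ n) (a : ℝ) : batchMean n b (fun _ => a) = a := by
  have h : ((n.choose b : ℕ) : ℝ) ≠ 0 := Nat.cast_ne_zero.2 (Nat.choose_pos hbn).ne'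
  simp only [batchMean, Finset.sum_const, Finset.card_powersetCard, Finset.card_univ,
    Fintype.card_fin, nsmul_eq_mul]
  field_simp

lemma batchMean_mono {φ χ : Finset (Fin n) → ℝ} (h : ∀ S, S.card = b → φ S ≤ χ S) :
    batchMean n b φ ≤ batchMean n b χ :=
  mul_le_mul_of_nonneg_left (Finset.sum_le_sum fun S hS => h S (Finset.mem_powersetCard.1 hS).2)
    (by positivity)

/-- Every index lies in a batch with probability `b / n`. -/
lemma batchMean_sum (hb : 1 ≤ b) (hbn : b ≤ n) (a : Fin n → ℝ) :
    batchMean n b (fun S => ∑ i ∈ S, a i) = (b : ℝ) / n * ∑ i, a i := by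
  have hcount : ∀ i : Fin n, ((Finset.powersetCard b (Finset.univ : Finset (Fin n))).filter
      (fun S => i ∈ S)).card = (n - 1).choose (b - 1) := fun i => by
    have h := Finset.card_filter_powersetCard_subset {i} (Finset.univ : Finset (Fin n)) b
      (by simp) (by simpa using hb)
    simpa using h
  have hsum : ∑ S ∈ Finset.powersetCard b (Finset.univ : Finset (Fin n)), ∑ i ∈ S, a i =
      ((n - 1).choose (b - 1) : ℝ) * ∑ i, a i := by
    calc _ = ∑ S ∈ Finset.powersetCard b (Finset.univ : Finset (Fin n)),
          ∑ i, if i ∈ S then a i else 0 := by simp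
      _ = ∑ i, ∑ S ∈ Finset.powersetCard b (Finset.univ : Finset (Fin n)),
          if i ∈ S then a i else 0 := Finset.sum_comm
      _ = _ := by
        rw [Finset.mul_sum]
        refine Finset.sum_congr rfl fun i _ => ?_
        rw [← Finset.sum_filter, Finset.sum_const, hcount, nsmul_eq_mul]
  have hid : (n : ℝ) * ((n - 1).choose (b - 1) : ℝ) = (n.choose b : ℝ) * b := by
    obtain ⟨n, rfl⟩ := Nat.exists_eq_succ_of_ne_zero (by omega : n ≠ 0)
    obtain ⟨b, rfl⟩ := Nat.exists_eq_succ_of_ne_zero (by omega : b ≠ 0)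
    exact_mod_cast Nat.add_one_mul_choose_eq n b
  have hn : (n : ℝ) ≠ 0 := Nat.cast_ne_zero.2 (by omega)
  have hc : ((n.choose b : ℕ) : ℝ) ≠ 0 := Nat.cast_ne_zero.2 (Nat.choose_pos hbn).ne'
  rw [batchMean, hsum]
  field_simp
  linear_combination (∑ i, a i) * hid

variable {H : Type*} [NormedAddCommGroup H] [InnerProductSpace ℝ H]

lemma batchMean_inner (hb : 1 ≤ b) (hbn : b ≤ n) (ξ : Fin n → H) (a v : H) :
    batchMean n b (fun S => inner ℝ
      ((1 / (b : ℝ)) • ∑ i ∈ S, ξ i - (1 / (n : ℝ)) • ∑ i, ξ i + a) v) = inner ℝ a v := by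
  have hb0 : (b : ℝ) ≠ 0 := Nat.cast_ne_zero.2 (by omega)
  have hn : (n : ℝ) ≠ 0 := Nat.cast_ne_zero.2 (by omega)
  have h : ∀ S : Finset (Fin n), inner ℝ
      ((1 / (b : ℝ)) • ∑ i ∈ S, ξ i - (1 / (n : ℝ)) • ∑ i, ξ i + a) v =
      (1 / (b : ℝ)) * ∑ i ∈ S, inner ℝ (ξ i) v +
        (inner ℝ a v - 1 / (n : ℝ) * ∑ i, inner ℝ (ξ i) v) := fun S => by
    rw [inner_add_left, inner_sub_left, real_inner_smul_left, real_inner_smul_left, sum_inner,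
      sum_inner]
    ring
  simp only [h]
  rw [batchMean_add, batchMean_const_mul, batchMean_sum hb hbn, batchMean_const hbn]
  field_simp
  ring

/-- Cauchy–Schwarz inside the batch replaces the squared batch average by the average of squares.
Only single-index inclusion probabilities are then needed, at the price of the variance reduction in
b. -/
lemma batchMean_norm_sq_le (hb : 1 ≤ b) (hbn : b ≤ n) (ξ : Fin n → H) (a : H) :
    batchMean n b (fun S =>
      ‖(1 / (b : ℝ)) • ∑ i ∈ S, ξ i - (1 / (n : ℝ)) • ∑ i, ξ i + a‖ ^ 2) ≤
      ‖a‖ ^ 2 + 1 / (n : ℝ) * ∑ i, ‖ξ i‖ ^ 2 := by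
  have hb0 : (0 : ℝ) < b := Nat.cast_pos.2 (by omega)
  have hn : (0 : ℝ) < n := Nat.cast_pos.2 (by omega)
  set m := (1 / (n : ℝ)) • ∑ i, ξ i with hm
  have h : ∀ S : Finset (Fin n), S.card = b →
      ‖(1 / (b : ℝ)) • ∑ i ∈ S, ξ i - m + a‖ ^ 2 ≤
      (1 / (b : ℝ)) * ∑ i ∈ S, (‖ξ i‖ ^ 2 + 2 * inner ℝ (ξ i) (a - m)) + ‖a - m‖ ^ 2 := by
    intro S hS
    have h1 : ‖∑ i ∈ S, ξ i‖ ^ 2 ≤ S.card * ∑ i ∈ S, ‖ξ i‖ ^ 2 :=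
      (pow_le_pow_left₀ (norm_nonneg _) (norm_sum_le _ _) 2).trans sq_sum_le_card_mul_sum_sq
    rw [hS] at h1
    rw [show (1 / (b : ℝ)) • ∑ i ∈ S, ξ i - m + a = (1 / (b : ℝ)) • ∑ i ∈ S, ξ i + (a - m) by abel,
      norm_add_sq_real, norm_smul, real_inner_smul_left, sum_inner, Finset.sum_add_distrib,
      ← Finset.mul_sum, mul_pow, Real.norm_eq_abs, sq_abs]
    have h2 : (1 / (b : ℝ)) ^ 2 * ‖∑ i ∈ S, ξ i‖ ^ 2 ≤ 1 / (b : ℝ) * ∑ i ∈ S, ‖ξ i‖ ^ 2 := by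
      refine (mul_le_mul_of_nonneg_left h1 (by positivity)).trans_eq ?_
      field_simp
    linarith
  refine (batchMean_mono h).trans ?_
  rw [batchMean_add, batchMean_const_mul, batchMean_sum hb hbn, batchMean_const hbn,
    Finset.sum_add_distrib, ← Finset.mul_sum, ← sum_inner]
  have h3 : inner ℝ (∑ i, ξ i) (a - m) = n * inner ℝ m (a - m) := by
    rw [hm, real_inner_smul_left]
    field_simp
  have h4 : ‖a‖ ^ 2 = ‖m‖ ^ 2 + 2 * inner ℝ m (a - m) + ‖a - m‖ ^ 2 := by
    rw [← norm_add_sq_real, add_sub_cancel]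
  rw [h3, h4]
  have h5 : 1 / (b : ℝ) * (b / n * (∑ i, ‖ξ i‖ ^ 2 + 2 * (n * inner ℝ m (a - m)))) =
      1 / n * ∑ i, ‖ξ i‖ ^ 2 + 2 * inner ℝ m (a - m) := by
    field_simp
  rw [h5]
  nlinarith [sq_nonneg ‖m‖]

lemma batchMean_sum_ite (hb : 1 ≤ b) (hbn : b ≤ n) (A B : Fin n → ℝ) :
    batchMean n b (fun S => ∑ i, if i ∈ S then A i else B i) =
      ∑ i, ((b : ℝ) / n * A i + (1 - (b : ℝ) / n) * B i) := by
  have h : ∀ S : Finset (Fin n), (∑ i, if i ∈ S then A i else B i) =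
      ∑ i ∈ S, (A i - B i) + ∑ i, B i := fun S => by
    have h' : ∑ i ∈ S, (A i - B i) = ∑ i, if i ∈ S then A i - B i else 0 := by simp
    rw [h', ← Finset.sum_add_distrib]
    refine Finset.sum_congr rfl fun i _ => ?_
    split_ifs <;> ring
  simp only [h]
  rw [batchMean_add, batchMean_sum hb hbn, batchMean_const hbn, Finset.mul_sum,
    ← Finset.sum_add_distrib]
  exact Finset.sum_congr rfl fun i _ => by ring

end BatchMean

/-! ### One iteration: error recursions and descent. -/

section OneStep

variable {m n b : ℕ} {f : Fin n → E m → ℝ} {g : E m → EReal} {L : ℝ≥0} {xstar : E m}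

/-- The error of the gradient estimate. -/
noncomputable def estErr (f : Fin n → E m → ℝ) (s : State m n) : E m := s.est - meanGrad f s.x

/-- The deviation of a table entry from its stationary value. -/
noncomputable def tableErr (f : Fin n → E m → ℝ) (b : ℕ) (s : State m n) (i : Fin n) : E m :=
  ((b : ℝ) / n) • gradient (f i) s.x - s.ψ i

noncomputable def tableErrSq (f : Fin n → E m → ℝ) (b : ℕ) (s : State m n) : ℝ :=
  1 / (n : ℝ) * ∑ i, ‖tableErr f b s i‖ ^ 2

/-- The mean squared change of the component gradients between two points. -/
noncomputable def gradChange (f : Fin n → E m → ℝ) (x x' : E m) : ℝ :=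
  1 / (n : ℝ) * ∑ i, ‖gradient (f i) x' - gradient (f i) x‖ ^ 2

/-- The form that exposes the bias: a centred sampling error, which averages to zero, plus 1 - b/n
times the old error. -/
lemma estErr_step (hb : 1 ≤ b) (hbn : b ≤ n) (γ τ : ℝ) (s : State m n) {S : Finset (Fin n)} :
    estErr f (step f g b γ τ S s) =
      (1 / (b : ℝ)) • ∑ i ∈ S, ((gradient (f i) (τ • s.z + (1 - τ) • s.y) - gradient (f i) s.x)
          + tableErr f b s i)
        - (1 / (n : ℝ)) • ∑ i, ((gradient (f i) (τ • s.z + (1 - τ) • s.y) - gradient (f i) s.x)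
          + tableErr f b s i) + (1 - (b : ℝ) / n) • estErr f s := by
  have hb0 : (b : ℝ) ≠ 0 := Nat.cast_ne_zero.2 (by omega)
  have hn : (n : ℝ) ≠ 0 := Nat.cast_ne_zero.2 (by omega)
  simp only [estErr, step, estimate, meanGrad, tableErr, Finset.sum_add_distrib,
    Finset.sum_sub_distrib, ← Finset.smul_sum]
  module

lemma batchMean_inner_estErr (hb : 1 ≤ b) (hbn : b ≤ n) (γ τ : ℝ) (s : State m n) (v : E m) :
    batchMean n b (fun S => inner ℝ (estErr f (step f g b γ τ S s)) v) =
      (1 - (b : ℝ) / n) * inner ℝ (estErr f s) v := by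
  simp only [estErr_step hb hbn]
  rw [batchMean_inner hb hbn, real_inner_smul_left]

lemma batchMean_norm_estErr_sq_le (hb : 1 ≤ b) (hbn : b ≤ n) (γ τ : ℝ) (s : State m n) :
    batchMean n b (fun S => ‖estErr f (step f g b γ τ S s)‖ ^ 2) ≤
      (1 - (b : ℝ) / n) ^ 2 * ‖estErr f s‖ ^ 2
        + 2 * gradChange f s.x (τ • s.z + (1 - τ) • s.y) + 2 * tableErrSq f b s := by
  simp only [estErr_step hb hbn]
  refine (batchMean_norm_sq_le hb hbn _ _).trans ?_
  rw [norm_smul, mul_pow, Real.norm_eq_abs, sq_abs, gradChange, tableErrSq, add_assoc,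
    mul_left_comm, mul_left_comm 2, ← mul_add, Finset.mul_sum _ _ (2 : ℝ),
    Finset.mul_sum _ _ (2 : ℝ), ← Finset.sum_add_distrib]
  refine add_le_add_right (mul_le_mul_of_nonneg_left
    (Finset.sum_le_sum fun i _ => ?_) (by positivity)) _
  set p := gradient (f i) (τ • s.z + (1 - τ) • s.y) - gradient (f i) s.x
  have h := parallelogram_law_with_norm ℝ p (tableErr f b s i)
  nlinarith [sq_nonneg ‖p - tableErr f b s i‖]

lemma norm_add_smul_sq_le {H : Type*} [NormedAddCommGroup H] [InnerProductSpace ℝ H] {ρ : ℝ}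
    (h0 : 0 ≤ ρ) (u d : H) :
    ‖u + ρ • d‖ ^ 2 ≤ (1 + ρ / 4) * ‖u‖ ^ 2 + (ρ ^ 2 + 4 * ρ) * ‖d‖ ^ 2 := by
  rw [norm_add_sq_real, norm_smul, mul_pow, Real.norm_eq_abs, sq_abs, real_inner_smul_right]
  have h1 := real_inner_le_norm u d
  nlinarith [mul_le_mul_of_nonneg_left h1 h0, mul_nonneg h0 (sq_nonneg (‖u‖ - 4 * ‖d‖))]

/-- With ρ = b/n and dᵢ the change of the i-th gradient, a refreshed entry has error -(1 - ρ)dᵢ and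
forgets its past; a stale one drifts by ρdᵢ. Young's inequality gives back only ρ/4 of the
contraction by 1 - ρ. -/
lemma batchMean_tableErrSq_le (hb : 1 ≤ b) (hbn : b ≤ n) (γ τ : ℝ) (s : State m n) :
    batchMean n b (fun S => tableErrSq f b (step f g b γ τ S s)) ≤
      (1 - 3 * ((b : ℝ) / n) / 4) * tableErrSq f b s
        + 5 * ((b : ℝ) / n) * gradChange f s.x (τ • s.z + (1 - τ) • s.y) := by
  have hn : (0 : ℝ) < n := Nat.cast_pos.2 (by omega)
  set ρ : ℝ := (b : ℝ) / n with hρ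
  have hρ0 : 0 ≤ ρ := by positivity
  have hρ1 : ρ ≤ 1 := div_le_one_of_le₀ (Nat.cast_le.2 hbn) hn.le
  set x' := τ • s.z + (1 - τ) • s.y with hx'
  let d : Fin n → E m := fun i => gradient (f i) x' - gradient (f i) s.x
  have h : ∀ S : Finset (Fin n), tableErrSq f b (step f g b γ τ S s) =
      1 / (n : ℝ) * ∑ i, if i ∈ S then (1 - ρ) ^ 2 * ‖d i‖ ^ 2
        else ‖tableErr f b s i + ρ • d i‖ ^ 2 := fun S => by
    rw [tableErrSq]
    congr 1
    refine Finset.sum_congr rfl fun i _ => ?_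
    simp only [tableErr, step, ← hx', ← hρ, d]
    split_ifs
    · rw [← sq_abs (1 - ρ), ← Real.norm_eq_abs, ← mul_pow, ← norm_smul, ← norm_neg]
      congr 2
      module
    · congr 2
      module
  simp only [h]
  rw [batchMean_const_mul, batchMean_sum_ite hb hbn, tableErrSq, gradChange, mul_left_comm,
    mul_left_comm (5 * ρ), ← mul_add, Finset.mul_sum _ _ (1 - 3 * ρ / 4),
    Finset.mul_sum _ _ (5 * ρ), ← Finset.sum_add_distrib]
  refine mul_le_mul_of_nonneg_left (Finset.sum_le_sum fun i _ => ?_) (by positivity)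
  have h1 := norm_add_smul_sq_le hρ0 (tableErr f b s i) (d i)
  have h2 := mul_le_mul_of_nonneg_left h1 (sub_nonneg.2 hρ1)
  have h3 : (1 - ρ) * (1 + ρ / 4) ≤ 1 - 3 * ρ / 4 := by nlinarith
  have h4 : ρ * (1 - ρ) ^ 2 + (1 - ρ) * (ρ ^ 2 + 4 * ρ) ≤ 5 * ρ := by nlinarith
  have h5 := mul_le_mul_of_nonneg_right h3 (sq_nonneg ‖tableErr f b s i‖)
  have h6 := mul_le_mul_of_nonneg_right h4 (sq_nonneg ‖d i‖)
  rw [← hρ]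
  change _ ≤ (1 - 3 * ρ / 4) * ‖tableErr f b s i‖ ^ 2 + 5 * ρ * ‖d i‖ ^ 2
  linarith

/-- The pivot y is the previous output point: the Bregman term is then the one that
`IsProblem.descent` subtracts, and ‖y - x‖² is carried by the Lyapunov function. -/
lemma IsProblem.gradChange_le (hp : IsProblem f g L xstar) (x x' y : E m) :
    gradChange f x x' ≤
      4 * L * (smooth f y - smooth f x' - inner ℝ (meanGrad f x') (y - x'))
        + 2 * L ^ 2 * ‖y - x‖ ^ 2 := by
  have hn : (0 : ℝ) < n := Nat.cast_pos.2 hp.n_pos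
  have h1 := hp.mean_norm_gradient_sub_sq_le x' y
  have h2 : ∀ i, ‖gradient (f i) x' - gradient (f i) x‖ ^ 2 ≤
      2 * ‖gradient (f i) x' - gradient (f i) y‖ ^ 2 + 2 * (L ^ 2 * ‖y - x‖ ^ 2) := fun i => by
    have h3 := (hp.lip i).dist_le_mul y x
    rw [dist_eq_norm, dist_eq_norm] at h3
    have h4 := norm_sub_le_norm_sub_add_norm_sub (gradient (f i) x') (gradient (f i) y)
      (gradient (f i) x)
    have h5 := pow_le_pow_left₀ (norm_nonneg _) (h4.trans (add_le_add_right h3 _)) 2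
    refine h5.trans ?_
    nlinarith [sq_nonneg (‖gradient (f i) x' - gradient (f i) y‖ - L * ‖y - x‖)]
  have h6 := mul_le_mul_of_nonneg_left (Finset.sum_le_sum fun i (_ : i ∈ Finset.univ) => h2 i)
    (by positivity : 0 ≤ 1 / (n : ℝ))
  rw [Finset.sum_add_distrib, ← Finset.mul_sum, Finset.sum_const, Finset.card_univ,
    Fintype.card_fin, nsmul_eq_mul] at h6
  have h7 : 1 / (n : ℝ) * (2 * ∑ i, ‖gradient (f i) x' - gradient (f i) y‖ ^ 2
      + n * (2 * (L ^ 2 * ‖y - x‖ ^ 2))) =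
      2 * (1 / (n : ℝ) * ∑ i, ‖gradient (f i) x' - gradient (f i) y‖ ^ 2)
        + 2 * L ^ 2 * ‖y - x‖ ^ 2 := by field_simp
  rw [gradChange]
  linarith

/-- The descent inequality along one iteration, for an arbitrary gradient estimate. -/
lemma IsProblem.descent (hp : IsProblem f g L xstar) {μ : ℝ} (hg : StronglyConvex μ g)
    {γ τ : ℝ} (hγ : 0 < γ) (hτ0 : 0 < τ) (hτ1 : τ ≤ 1) {y z x' z' y' est : E m}
    (hx' : x' = τ • z + (1 - τ) • y) (hz' : z' = prox g γ (z - γ • est))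
    (hy' : y' = τ • z' + (1 - τ) • y) (hy : y ∈ effDom g) :
    γ / τ * (realObj f g y' - realObj f g xstar) + (1 + μ * γ) / 2 * ‖z' - xstar‖ ^ 2 ≤
      γ / τ * (1 - τ) * (realObj f g y - realObj f g xstar) + 1 / 2 * ‖z - xstar‖ ^ 2
        - γ / τ * (1 - τ) * (smooth f y - smooth f x' - inner ℝ (meanGrad f x') (y - x'))
        - (1 - L * (γ * τ)) / 2 * ‖z' - z‖ ^ 2
        - γ * inner ℝ (est - meanGrad f x') (z' - xstar) := by
  have hzm : z' ∈ effDom g := hz' ▸ hp.prox_mem hγ _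
  have h1 := hp.prox_le hg hγ (z - γ • est) hp.xstar_mem
  rw [← hz'] at h1
  have h2 := hp.smooth_le x' y'
  have h3 := hp.combo_le hzm hy hτ0.le hτ1
  rw [← hy'] at h3
  have h4 := hp.add_inner_meanGrad_le x' xstar
  have e1 : y' - x' = τ • (z' - z) := by rw [hy', hx']; module
  have e2 : inner ℝ (meanGrad f x') (y' - x') =
      τ * inner ℝ (meanGrad f x') (z' - xstar) + τ * inner ℝ (meanGrad f x') (xstar - x')
        + (1 - τ) * inner ℝ (meanGrad f x') (y - x') := by
    rw [← real_inner_smul_right, ← real_inner_smul_right, ← real_inner_smul_right,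
      ← inner_add_right, ← inner_add_right, hy']
    congr 1
    module
  have e3 : inner ℝ (z' - (z - γ • est)) (xstar - z') =
      1 / 2 * ‖z - xstar‖ ^ 2 - 1 / 2 * ‖z' - xstar‖ ^ 2 - 1 / 2 * ‖z' - z‖ ^ 2
        - γ * inner ℝ est (z' - xstar) := by
    have e4 : z - xstar = (z' - xstar) - (z' - z) := by abel
    rw [e4, norm_sub_sq_real, show z' - (z - γ • est) = (z' - z) + γ • est by abel,
      ← neg_sub z' xstar, inner_neg_right, inner_add_left, real_inner_smul_left,
      real_inner_comm (z' - xstar) (z' - z)]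
    ring
  rw [e2, e1, norm_smul, mul_pow, Real.norm_eq_abs, sq_abs] at h2
  rw [e3, norm_sub_rev xstar z'] at h1
  rw [inner_sub_left]
  have hτ4 := mul_le_mul_of_nonneg_left h4 hτ0.le
  -- Convexity of f is applied only towards `xstar`; towards y the exact Bregman divergence is kept,
  -- to pay later for the gradient change.
  have key : realObj f g y' - realObj f g xstar ≤
      (1 - τ) * (realObj f g y - realObj f g xstar)
        - (1 - τ) * (smooth f y - smooth f x' - inner ℝ (meanGrad f x') (y - x'))
        + τ * (inner ℝ (meanGrad f x') (z' - xstar) + (g z').toReal - (g xstar).toReal)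
        + L / 2 * (τ ^ 2 * ‖z' - z‖ ^ 2) := by
    simp only [realObj]
    linarith
  have key' := mul_le_mul_of_nonneg_left key (by positivity : 0 ≤ γ / τ)
  have e5 : γ / τ * ((1 - τ) * (realObj f g y - realObj f g xstar)
        - (1 - τ) * (smooth f y - smooth f x' - inner ℝ (meanGrad f x') (y - x'))
        + τ * (inner ℝ (meanGrad f x') (z' - xstar) + (g z').toReal - (g xstar).toReal)
        + L / 2 * (τ ^ 2 * ‖z' - z‖ ^ 2)) =
      γ / τ * (1 - τ) * (realObj f g y - realObj f g xstar)
        - γ / τ * (1 - τ) * (smooth f y - smooth f x' - inner ℝ (meanGrad f x') (y - x'))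
        + γ * (inner ℝ (meanGrad f x') (z' - xstar) + (g z').toReal - (g xstar).toReal)
        + L * (γ * τ) / 2 * ‖z' - z‖ ^ 2 := by
    field_simp
  rw [e5] at key'
  linarith

end OneStep

/-! ### Contraction of the Lyapunov function. -/

section Lyapunov

variable {m n b : ℕ} {f : Fin n → E m → ℝ} {g : E m → EReal} {L : ℝ≥0} {xstar : E m}

/-- The Lyapunov function of the method: suboptimality, distance to the minimiser, correlation of
the estimation error with the iterate, and the sizes of the errors in the estimate and the table. -/
noncomputable def lyapunov (f : Fin n → E m → ℝ) (g : E m → EReal) (b : ℕ) (L : ℝ≥0)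
    (xstar : E m) (γ v h : ℝ) (s : State m n) : ℝ :=
  v * (realObj f g s.y - realObj f g xstar) + 1 / 2 * ‖s.z - xstar‖ ^ 2
    - (1 - (b : ℝ) / n) * h * inner ℝ (estErr f s) (s.z - xstar)
    + 5 * (γ ^ 2 / ((b : ℝ) / n) ^ 3) * ‖estErr f s‖ ^ 2
    + 112 * (γ ^ 2 / ((b : ℝ) / n) ^ 4) * tableErrSq f b s
    + 1800 * L ^ 2 * (γ ^ 2 / ((b : ℝ) / n) ^ 3) * ‖s.y - s.x‖ ^ 2

lemma tableErrSq_nonneg (f : Fin n → E m → ℝ) (b : ℕ) (s : State m n) :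
    0 ≤ tableErrSq f b s :=
  mul_nonneg (by positivity) (Finset.sum_nonneg fun _ _ => by positivity)

lemma gradChange_nonneg (f : Fin n → E m → ℝ) (x x' : E m) : 0 ≤ gradChange f x x' :=
  mul_nonneg (by positivity) (Finset.sum_nonneg fun _ _ => by positivity)

lemma mul_sq_le_of_mul_le {ρ lam γ γ' : ℝ} (hρ0 : 0 ≤ ρ) (hρ1 : ρ ≤ 1) (hlam : 1 ≤ lam)
    (hγ' : 0 ≤ γ') (h : lam * γ' ≤ (1 + ρ / 4) * γ) :
    lam * γ' ^ 2 ≤ (1 + 9 * ρ / 16) * γ ^ 2 := by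
  have h1 : γ' ≤ (1 + ρ / 4) * γ := (le_mul_of_one_le_left hγ' hlam).trans h
  calc lam * γ' ^ 2 = (lam * γ') * γ' := by ring
    _ ≤ ((1 + ρ / 4) * γ) * ((1 + ρ / 4) * γ) := mul_le_mul h h1 hγ' (hγ'.trans h1)
    _ = (1 + ρ / 2 + ρ ^ 2 / 16) * γ ^ 2 := by ring
    _ ≤ _ := mul_le_mul_of_nonneg_right (by nlinarith) (sq_nonneg γ)

/-- The bound 4γ/(3ρ) is preserved by the recursion because (1 + ρ/4)(1 - ρ) ≤ 1 - 3ρ/4. -/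
lemma correlation_weight_le {ρ lam γ γ' h' : ℝ} (hρ0 : 0 < ρ) (hρ1 : ρ ≤ 1) (hγ : 0 ≤ γ)
    (hlam : 1 ≤ lam) (h : lam * γ' ≤ (1 + ρ / 4) * γ) (hh' : h' ≤ 4 / 3 * γ' / ρ) :
    γ + lam * (1 - ρ) * h' ≤ 4 / 3 * γ / ρ := by
  rw [le_div_iff₀ hρ0] at hh' ⊢
  have h1 := mul_le_mul_of_nonneg_left hh'
    (mul_nonneg (zero_le_one.trans hlam) (sub_nonneg.2 hρ1))
  have h2 := mul_le_mul_of_nonneg_right h (sub_nonneg.2 hρ1)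
  nlinarith [mul_nonneg hρ0.le hγ, mul_nonneg (sq_nonneg ρ) hγ]

/-- Here B = γ²/ρ⁴, B' is λ times its successor, and 5ρB' + h² weighs the new squared error after
Young's inequality. The three bounds match the coefficients of the estimate error, the table error
and the gradient change. In the second, 112 · 3/16 = 21 covers the 20 coming from the estimate
error; in the third, 20 + 875 ≤ 900. -/
lemma error_weights {ρ B B' h : ℝ} (hρ0 : 0 ≤ ρ) (hρ1 : ρ ≤ 1) (hB : 0 ≤ B)
    (hBB' : B' ≤ (1 + 9 * ρ / 16) * B) (hh : h ^ 2 ≤ 16 / 9 * (ρ ^ 2 * B)) :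
    (5 * (ρ * B') + h ^ 2) * (1 - ρ) ^ 2 ≤ 5 * (ρ * B) ∧
      2 * (5 * (ρ * B') + h ^ 2) + 112 * B' * (1 - 3 * ρ / 4) ≤ 112 * B ∧
      2 * (5 * (ρ * B') + h ^ 2) + 5 * ρ * (112 * B') ≤ 900 * (ρ * B) := by
  have hρB : 0 ≤ ρ * B := by positivity
  have hM : 5 * (ρ * B') + h ^ 2 ≤ (5 + 661 / 144 * ρ) * (ρ * B) := by
    have := mul_le_mul_of_nonneg_left hBB' hρ0
    -- 661/144 = 5 · 9/16 + 16/9.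
    linarith
  have hM10 : 5 * (ρ * B') + h ^ 2 ≤ 10 * (ρ * B) :=
    hM.trans (mul_le_mul_of_nonneg_right (by linarith) hρB)
  refine ⟨?_, ?_, ?_⟩
  · have h1 : (5 + 661 / 144 * ρ) * (1 - ρ) ≤ 5 := by nlinarith
    have h2 : (5 + 661 / 144 * ρ) * (1 - ρ) ^ 2 ≤ 5 := by
      have := mul_le_mul_of_nonneg_right h1 (sub_nonneg.2 hρ1)
      linarith
    have h3 := mul_le_mul_of_nonneg_right hM (sq_nonneg (1 - ρ))
    have h4 := mul_le_mul_of_nonneg_right h2 hρB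
    linarith
  · have h1 := mul_le_mul_of_nonneg_right hBB' (by linarith : 0 ≤ 1 - 3 * ρ / 4)
    have h2 := mul_nonneg hρ0 hρB
    linarith
  · have h1 := mul_le_mul_of_nonneg_left hBB' hρ0
    have h2 : ρ * (ρ * B) ≤ ρ * B := mul_le_of_le_one_left hρB hρ1
    linarith

/-- The gradient change has weight 900ρB and costs 4L Bregman divergences, hence 3600. -/
lemma bregman_weight {ρ L γ τ : ℝ} (hρ0 : 0 < ρ) (hρ1 : ρ ≤ 1) (hL : 0 < L) (hγ : 0 < γ)
    (hτ0 : 0 < τ) (hτ1 : τ ≤ 1 / 4) (hc : 86016 * L * (γ * τ) ≤ ρ ^ 4) :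
    3600 * L * (ρ * (γ ^ 2 / ρ ^ 4)) ≤ γ / τ * (1 - τ) := by
  have h1 : 86016 * L * (γ ^ 2 / ρ ^ 4) ≤ γ / τ := by
    rw [← mul_div_assoc, div_le_div_iff₀ (by positivity) hτ0]
    linarith [mul_le_mul_of_nonneg_left hc hγ.le]
  have h2 := mul_le_mul_of_nonneg_right h1 (by linarith : 0 ≤ 1 - τ)
  have h3 : 0 ≤ L * (γ ^ 2 / ρ ^ 4) := by positivity
  have h4 := mul_le_mul_of_nonneg_right hρ1 h3
  have h5 := mul_le_mul_of_nonneg_right hτ1 h3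
  linarith

lemma displacement_weight {ρ L γ τ B B' : ℝ} (hρ0 : 0 < ρ) (hρ1 : ρ ≤ 1) (hL : 0 < L)
    (hγ : 0 < γ) (hτ0 : 0 < τ) (hc : 86016 * L * (γ * τ) ≤ ρ ^ 4)
    (hBB' : B' ≤ (1 + 9 * ρ / 16) * B) (hB : B = γ ^ 2 / ρ ^ 4) :
    L * (γ * τ) ≤ 1 / 86016 ∧ 1800 * L ^ 2 * (ρ * B') * τ ^ 2 ≤ 1 / 8 := by
  have hρ4 : ρ ^ 4 ≤ 1 := pow_le_one₀ hρ0.le hρ1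
  have hB0 : 0 ≤ B := by rw [hB]; positivity
  refine ⟨by linarith, ?_⟩
  have h1 : ρ * B' ≤ 25 / 16 * (ρ * B) := by
    have h := mul_le_mul_of_nonneg_left hBB' hρ0.le
    have h' : ρ * (ρ * B) ≤ ρ * B := mul_le_of_le_one_left (by positivity) hρ1
    linarith
  have h2 : 1800 * L ^ 2 * (ρ * B') * τ ^ 2 ≤ 1800 * L ^ 2 * (25 / 16 * (ρ * B)) * τ ^ 2 := by
    gcongr
  have h3 : L ^ 2 * (ρ * B) * τ ^ 2 = (L * (γ * τ)) ^ 2 / ρ ^ 3 := by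
    rw [hB]; field_simp
  have h4 : (L * (γ * τ)) ^ 2 / ρ ^ 3 ≤ (ρ ^ 4 / 86016) ^ 2 / ρ ^ 3 := by
    have : L * (γ * τ) ≤ ρ ^ 4 / 86016 := by linarith
    gcongr
  have h5 : (ρ ^ 4 / 86016) ^ 2 / ρ ^ 3 = ρ ^ 5 / 86016 ^ 2 := by field_simp
  have h6 : ρ ^ 5 ≤ 1 := pow_le_one₀ hρ0.le hρ1
  linarith

lemma neg_mul_inner_le {H : Type*} [NormedAddCommGroup H] [InnerProductSpace ℝ H] {h : ℝ}
    (h0 : 0 ≤ h) (e d : H) :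
    -(h * inner ℝ e d) ≤ 1 / 4 * ‖d‖ ^ 2 + h ^ 2 * ‖e‖ ^ 2 := by
  have h1 := mul_le_mul_of_nonneg_left (neg_le_of_abs_le (abs_real_inner_le_norm e d)) h0
  linarith [sq_nonneg (1 / 2 * ‖d‖ - h * ‖e‖)]

/-- The expected Lyapunov function contracts by the factor `lam` along one iteration. -/
lemma IsProblem.batchMean_lyapunov_le (hp : IsProblem f g L xstar) (hb : 1 ≤ b) (hbn : b ≤ n)
    {μ : ℝ} (hg : StronglyConvex μ g) {γ γ' τ lam v v' h' : ℝ} (hγ : 0 < γ) (hγ' : 0 ≤ γ')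
    (hτ0 : 0 < τ) (hτ1 : τ ≤ 1 / 4) (hlam : 1 ≤ lam) (hlamμ : lam ≤ 1 + μ * γ)
    (hv' : lam * v' ≤ γ / τ) (hv : γ / τ * (1 - τ) ≤ v)
    (hγγ' : lam * γ' ≤ (1 + (b : ℝ) / n / 4) * γ) (hc : c n b * L * (γ * τ) ≤ 1)
    (hh0 : 0 ≤ h') (hh' : h' ≤ 4 / 3 * γ' / ((b : ℝ) / n)) {s : State m n}
    (hs : s.y ∈ effDom g) :
    batchMean n b (fun S => lam * lyapunov f g b L xstar γ' v' h' (step f g b γ τ S s)) ≤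
      lyapunov f g b L xstar γ v (γ + lam * (1 - (b : ℝ) / n) * h') s := by
  have hb0 : (0 : ℝ) < b := Nat.cast_pos.2 (by omega)
  have hn : (0 : ℝ) < n := Nat.cast_pos.2 (by omega)
  have hL : (0 : ℝ) < L := hp.L_pos
  have hcρ : c n b = 86016 / ((b : ℝ) / n) ^ 4 := by rw [c]; field_simp
  have hweight := correlation_weight_le (div_pos hb0 hn)
    (div_le_one_of_le₀ (Nat.cast_le.2 hbn) hn.le) hγ.le hlam hγγ' hh'
  have hsq := mul_sq_le_of_mul_le (div_pos hb0 hn).le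
    (div_le_one_of_le₀ (Nat.cast_le.2 hbn) hn.le) hlam hγ' hγγ'
  have hinner := fun v => batchMean_inner_estErr (f := f) (g := g) hb hbn γ τ s v
  have herr := batchMean_norm_estErr_sq_le (f := f) (g := g) hb hbn γ τ s
  have htab := batchMean_tableErrSq_le (f := f) (g := g) hb hbn γ τ s
  set x' := τ • s.z + (1 - τ) • s.y with hx'
  have hchange := hp.gradChange_le s.x x' s.y
  have hbreg : 0 ≤ smooth f s.y - smooth f x' - inner ℝ (meanGrad f x') (s.y - x') := by
    linarith [hp.add_inner_meanGrad_le x' s.y]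
  have hU := tableErrSq_nonneg f b s
  have hD := gradChange_nonneg f s.x x'
  have hF := hp.realObj_le hs
  have hρ0 : 0 < (b : ℝ) / n := div_pos hb0 hn
  have hρ1 : (b : ℝ) / n ≤ 1 := div_le_one_of_le₀ (Nat.cast_le.2 hbn) hn.le
  simp only [lyapunov]
  set ρ : ℝ := (b : ℝ) / n with hρ
  set h := γ + lam * (1 - ρ) * h' with hh
  set breg := smooth f s.y - smooth f x' - inner ℝ (meanGrad f x') (s.y - x')
  set D := gradChange f s.x x'
  set U := tableErrSq f b s
  have hh_nonneg : 0 ≤ h :=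
    add_nonneg hγ.le (mul_nonneg (mul_nonneg (by linarith) (sub_nonneg.2 hρ1)) hh0)
  set B := γ ^ 2 / ρ ^ 4 with hB
  set B' := lam * (γ' ^ 2 / ρ ^ 4) with hB'
  have hB0 : 0 ≤ B := by positivity
  have hB'0 : 0 ≤ B' := by positivity
  have hA : γ ^ 2 / ρ ^ 3 = ρ * B := by rw [hB]; field_simp
  have hA' : lam * (γ' ^ 2 / ρ ^ 3) = ρ * B' := by rw [hB']; field_simp
  have hγB : γ ^ 2 = ρ ^ 4 * B := by rw [hB]; field_simp
  have hBB' : B' ≤ (1 + 9 * ρ / 16) * B := by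
    rw [hB, hB', ← mul_div_assoc, ← mul_div_assoc]
    exact div_le_div_of_nonneg_right hsq (by positivity)
  have hhB : h ^ 2 ≤ 16 / 9 * (ρ ^ 2 * B) := by
    refine (pow_le_pow_left₀ hh_nonneg hweight 2).trans_eq ?_
    rw [hB]
    field_simp
    norm_num
  set M := 5 * (ρ * B') + h ^ 2 with hM
  have hM0 : 0 ≤ M := by positivity
  have hρB : 0 ≤ ρ * B := by positivity
  obtain ⟨hM2, hQ, hDcoef⟩ := error_weights hρ0.le hρ1 hB0 hBB' hhB
  rw [← hM] at hM2 hQ hDcoef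
  rw [hcρ, div_mul_eq_mul_div, div_mul_eq_mul_div, div_le_one (by positivity)] at hc
  have hbregcoef : 3600 * L * (ρ * B) ≤ γ / τ * (1 - τ) := by
    rw [hB]
    exact bregman_weight hρ0 hρ1 hL hγ hτ0 hτ1 hc
  obtain ⟨hLγτ, hstep⟩ := displacement_weight hρ0 hρ1 hL hγ hτ0 hc hBB' hB
  have hpath : ∀ S : Finset (Fin n), S.card = b →
      lam * (v' * (realObj f g (step f g b γ τ S s).y - realObj f g xstar)
        + 1 / 2 * ‖(step f g b γ τ S s).z - xstar‖ ^ 2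
        - (1 - ρ) * h' * inner ℝ (estErr f (step f g b γ τ S s)) ((step f g b γ τ S s).z - xstar)
        + 5 * (γ' ^ 2 / ρ ^ 3) * ‖estErr f (step f g b γ τ S s)‖ ^ 2
        + 112 * (γ' ^ 2 / ρ ^ 4) * tableErrSq f b (step f g b γ τ S s)
        + 1800 * L ^ 2 * (γ' ^ 2 / ρ ^ 3)
          * ‖(step f g b γ τ S s).y - (step f g b γ τ S s).x‖ ^ 2) ≤
      (γ / τ * (1 - τ) * (realObj f g s.y - realObj f g xstar) + 1 / 2 * ‖s.z - xstar‖ ^ 2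
        - γ / τ * (1 - τ) * breg)
        + ((-h) * inner ℝ (estErr f (step f g b γ τ S s)) (s.z - xstar)
        + (M * ‖estErr f (step f g b γ τ S s)‖ ^ 2
        + 112 * B' * tableErrSq f b (step f g b γ τ S s))) := by
    intro S _
    set s' := step f g b γ τ S s with hs'
    have hd := hp.descent hg hγ hτ0 (by linarith : τ ≤ 1) (z' := s'.z) (y' := s'.y)
      (est := s'.est) hx' rfl rfl hs
    have hym : s'.y ∈ effDom g := hp.combo_mem (hp.prox_mem hγ _) hs hτ0.le (by linarith)
    have he : s'.est - meanGrad f x' = estErr f s' := rfl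
    have hyx : s'.y - s'.x = τ • (s'.z - s.z) := by
      change τ • s'.z + (1 - τ) • s.y - (τ • s.z + (1 - τ) • s.y) = _
      module
    rw [he] at hd
    rw [hyx, norm_smul, mul_pow, Real.norm_eq_abs, sq_abs]
    have hsplit : inner ℝ (estErr f s') (s'.z - xstar) =
        inner ℝ (estErr f s') (s'.z - s.z) + inner ℝ (estErr f s') (s.z - xstar) := by
      rw [← inner_add_right, sub_add_sub_cancel]
    have hF' := sub_nonneg.2 (hp.realObj_le hym)
    have h1 := mul_le_mul_of_nonneg_right hv' hF'
    have h2 := mul_le_mul_of_nonneg_right hlamμ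
      (by positivity : 0 ≤ 1 / 2 * ‖s'.z - xstar‖ ^ 2)
    have h3 : -(h * inner ℝ (estErr f s') (s'.z - s.z)) ≤
        1 / 4 * ‖s'.z - s.z‖ ^ 2 + h ^ 2 * ‖estErr f s'‖ ^ 2 :=
      neg_mul_inner_le hh_nonneg _ _
    -- The negative ½‖z' - z‖² of descent pays for Young's inequality (1/4), the new ‖y - x‖² term
    -- (at most 1/8) and the smoothness error.
    have h5 : (1800 * L ^ 2 * (ρ * B') * τ ^ 2 - (1 - L * (γ * τ)) / 2 + 1 / 4)
        * ‖s'.z - s.z‖ ^ 2 ≤ 0 :=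
      mul_nonpos_of_nonpos_of_nonneg (by linarith only [hstep, hLγτ]) (sq_nonneg _)
    have h6 : lam * (5 * (γ' ^ 2 / ρ ^ 3) * ‖estErr f s'‖ ^ 2) =
        5 * (ρ * B') * ‖estErr f s'‖ ^ 2 := by rw [← hA']; ring
    have h7 : lam * (112 * (γ' ^ 2 / ρ ^ 4) * tableErrSq f b s') =
        112 * B' * tableErrSq f b s' := by rw [hB']; ring
    have h8 : lam * (1800 * L ^ 2 * (γ' ^ 2 / ρ ^ 3) * (τ ^ 2 * ‖s'.z - s.z‖ ^ 2)) =
        1800 * L ^ 2 * (ρ * B') * τ ^ 2 * ‖s'.z - s.z‖ ^ 2 := by rw [← hA']; ring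
    -- The future correlation and the bias term of the present step merge into the single weight h;
    -- this dictates its recursion.
    have h9 : lam * ((1 - ρ) * h' * inner ℝ (estErr f s') (s'.z - xstar))
        + γ * inner ℝ (estErr f s') (s'.z - xstar) =
        h * inner ℝ (estErr f s') (s'.z - s.z) + h * inner ℝ (estErr f s') (s.z - xstar) := by
      rw [← mul_add, ← hsplit, hh]; ring
    have h10 : M * ‖estErr f s'‖ ^ 2 =
        5 * (ρ * B') * ‖estErr f s'‖ ^ 2 + h ^ 2 * ‖estErr f s'‖ ^ 2 := by rw [hM]; ring
    linarith only [hd, h1, h2, h3, h5, h6, h7, h8, h9, h10]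
  refine (batchMean_mono hpath).trans ?_
  rw [batchMean_add, batchMean_add, batchMean_add, batchMean_const hbn, batchMean_const_mul,
    batchMean_const_mul, batchMean_const_mul, hinner, hA]
  have e1 := mul_le_mul_of_nonneg_left herr hM0
  have e2 := mul_le_mul_of_nonneg_left htab (by positivity : 0 ≤ 112 * B')
  have e3 := mul_le_mul_of_nonneg_right hM2 (sq_nonneg ‖estErr f s‖)
  have e4 := mul_le_mul_of_nonneg_right hQ hU
  have e5 := mul_le_mul_of_nonneg_right hDcoef hD
  have e6 := mul_le_mul_of_nonneg_left hchange (by positivity : 0 ≤ 900 * (ρ * B))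
  have e7 := mul_le_mul_of_nonneg_right hbregcoef hbreg
  have e8 := mul_le_mul_of_nonneg_right hv (sub_nonneg.2 hF)
  linarith only [e1, e2, e3, e4, e5, e6, e7, e8]

end Lyapunov

/-! ### Expectation over the batches. -/

section Expectation

variable {Ω : Type*} [MeasurableSpace Ω] {P : Measure Ω} [IsProbabilityMeasure P] {n b : ℕ}

/-- Integrating over a uniform batch independent of a finitely valued history. -/
lemma integral_batch {H : Type*} [Finite H] [MeasurableSpace H] [MeasurableSingletonClass H]
    (hbn : b ≤ n) {X : Ω → H} (hX : Measurable X) {Y : Ω → Finset (Fin n)}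
    (hY : ∀ S, MeasurableSet {ω | Y ω = S})
    (hind : @IndepFun Ω H (Finset (Fin n)) _ _ ⊤ X Y P)
    (hunif : ∀ S, S.card = b → P {ω | Y ω = S} = ((n.choose b : ℕ) : ℝ≥0∞)⁻¹)
    (φ : H → Finset (Fin n) → ℝ) :
    ∫ ω, φ (X ω) (Y ω) ∂P = ∫ ω, batchMean n b (φ (X ω)) ∂P := by
  let _ : MeasurableSpace (Finset (Fin n)) := ⊤
  have hYm : Measurable Y := measurable_to_countable' hY
  have hc0 : ((n.choose b : ℕ) : ℝ≥0∞) ≠ 0 := Nat.cast_ne_zero.2 (Nat.choose_pos hbn).ne'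
  have hcard : ∀ᵐ ω ∂P, Y ω ∈ Finset.powersetCard b Finset.univ := by
    have hset : {ω | Y ω ∈ Finset.powersetCard b Finset.univ} =
        ⋃ S ∈ Finset.powersetCard b Finset.univ, {ω | Y ω = S} := by
      ext ω; simp
    have hmeas : MeasurableSet {ω | Y ω ∈ Finset.powersetCard b Finset.univ} := by
      rw [hset]
      exact Finset.measurableSet_biUnion _ fun S _ => hY S
    have hone : P {ω | Y ω ∈ Finset.powersetCard b Finset.univ} = 1 := by
      rw [hset, measure_biUnion_finset
        (fun S _ S' _ h => Set.disjoint_left.2 fun ω h1 h2 => h (h1.symm.trans h2))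
        fun S _ => hY S,
        Finset.sum_congr rfl fun S hS => hunif S (Finset.mem_powersetCard.1 hS).2,
        Finset.sum_const, Finset.card_powersetCard, Finset.card_univ, Fintype.card_fin,
        nsmul_eq_mul, ENNReal.mul_inv_cancel hc0 (ENNReal.natCast_ne_top _)]
    exact (prob_compl_eq_zero_iff hmeas).2 hone
  have hae : (fun ω => φ (X ω) (Y ω)) =ᵐ[P] fun ω =>
      ∑ S ∈ Finset.powersetCard b Finset.univ, φ (X ω) S * (if Y ω = S then 1 else 0) := by
    filter_upwards [hcard] with ω hω
    simp only [mul_ite, mul_one, mul_zero, Finset.sum_ite_eq, if_pos hω]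
  have hint : ∀ S, Integrable (fun ω => φ (X ω) S) P := fun S =>
    (Integrable.of_finite (f := fun x => φ x S) (μ := P.map X)).comp_measurable hX
  have hprod : ∀ S, Integrable (fun ω => φ (X ω) S * (if Y ω = S then 1 else 0)) P := fun S =>
    (Integrable.of_finite (f := fun p : H × Finset (Fin n) =>
      φ p.1 S * (if p.2 = S then (1 : ℝ) else 0)) (μ := P.map fun ω => (X ω, Y ω))).comp_measurable
      (hX.prodMk hYm)
  rw [integral_congr_ae hae, integral_finsetSum _ fun S _ => hprod S]
  simp only [batchMean]
  rw [integral_const_mul, integral_finsetSum _ fun S _ => hint S, Finset.mul_sum]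
  refine Finset.sum_congr rfl fun S hS => ?_
  have h1 := hind.integral_fun_comp_mul_comp (f := fun x => φ x S)
    (g := fun S' => if S' = S then (1 : ℝ) else 0) hX.aemeasurable hYm.aemeasurable
    (Measurable.of_discrete.aestronglyMeasurable) (Measurable.of_discrete.aestronglyMeasurable)
  have h2 : ∫ ω, (if Y ω = S then (1 : ℝ) else 0) ∂P = ((n.choose b : ℕ) : ℝ)⁻¹ := by
    have h3 : (fun ω => if Y ω = S then (1 : ℝ) else 0) =
        Set.indicator {ω | Y ω = S} fun _ => (1 : ℝ) := by
      ext ω; simp [Set.indicator_apply]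
    rw [h3, integral_indicator_const _ (hY S), Measure.real,
      hunif S (Finset.mem_powersetCard.1 hS).2]
    simp
  rw [h1, h2, mul_comm]

variable {m : ℕ} {f : Fin n → E m → ℝ} {g : E m → EReal} {γ τ : ℕ → ℝ} {x₀ : E m}
  {J : ℕ → Ω → Finset (Fin n)}

lemma iter_congr {K K' : ℕ → Finset (Fin n)} {k : ℕ} (h : ∀ i < k, K i = K' i) :
    iter f g b γ τ x₀ K k = iter f g b γ τ x₀ K' k := by
  induction k with
  | zero => rfl
  | succ k ih =>
    simp only [iter]
    rw [h k (Nat.lt_succ_self k), ih fun i hi => h i (hi.trans (Nat.lt_succ_self k))]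

/-- The state after `k` iterations as a function of the first `k` batches. -/
noncomputable def iterOfHistory (f : Fin n → E m → ℝ) (g : E m → EReal) (b : ℕ) (γ τ : ℕ → ℝ)
    (x₀ : E m) (k : ℕ) (h : Finset.range k → Finset (Fin n)) : State m n :=
  -- The value ∅ is never read: k iterations use only batches with index below k.
  iter f g b γ τ x₀ (fun i => if hi : i ∈ Finset.range k then h ⟨i, hi⟩ else ∅) k

lemma iter_eq_iterOfHistory (K : ℕ → Finset (Fin n)) (k : ℕ) :
    iter f g b γ τ x₀ K k = iterOfHistory f g b γ τ x₀ k fun i => K i :=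
  iter_congr fun i hi => by simp [hi]

lemma measurable_history {P : Measure Ω} (hJ : IsUniformBatches P n b J) (k : ℕ) :
    Measurable[_, MeasurableSpace.pi (m := fun _ => ⊤)]
      (fun ω (i : Finset.range k) => J i ω) := by
  let _ : MeasurableSpace (Finset (Fin n)) := ⊤
  exact measurable_pi_lambda _ fun i => measurable_to_countable' (hJ.measurable i)

/-- The state depends on finitely many batches, each with finitely many values, so φ, the gradients
and the proximal map need no measurability. -/
lemma integrable_iter (hJ : IsUniformBatches P n b J) (k : ℕ) (φ : State m n → ℝ) :
    Integrable (fun ω => φ (iter f g b γ τ x₀ (fun i => J i ω) k)) P := by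
  let _ : MeasurableSpace (Finset (Fin n)) := ⊤
  simp only [iter_eq_iterOfHistory]
  exact (Integrable.of_finite (f := fun h => φ (iterOfHistory f g b γ τ x₀ k h))
    (μ := P.map fun ω (i : Finset.range k) => J i ω)).comp_measurable (measurable_history hJ k)

lemma integral_iter_succ (hbn : b ≤ n) (hJ : IsUniformBatches P n b J) (k : ℕ)
    (φ : State m n → ℝ) :
    ∫ ω, φ (iter f g b γ τ x₀ (fun i => J i ω) (k + 1)) ∂P =
      ∫ ω, batchMean n b (fun S =>
        φ (step f g b (γ k) (τ k) S (iter f g b γ τ x₀ (fun i => J i ω) k))) ∂P := by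
  let _ : MeasurableSpace (Finset (Fin n)) := ⊤
  simp only [iter, iter_eq_iterOfHistory]
  have hind := hJ.indep.indepFun_finset (Finset.range k) {k} (by simp)
    fun i => measurable_to_countable' (hJ.measurable i)
  have hind' : IndepFun (fun ω (i : Finset.range k) => J i ω) (J k) P :=
    hind.comp measurable_id
      (measurable_pi_apply (⟨k, Finset.mem_singleton_self k⟩ : ({k} : Finset ℕ)))
  exact integral_batch hbn (measurable_history hJ k) (hJ.measurable k)
    hind'
    (hJ.uniform k) fun h S => φ (step f g b (γ k) (τ k) S (iterOfHistory f g b γ τ x₀ k h))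

end Expectation

/-! ### Backward induction over the horizon. -/

section Convergence

variable {m n b : ℕ} {f : Fin n → E m → ℝ} {g : E m → EReal} {L : ℝ≥0} {xstar : E m}

lemma IsProblem.iter_y_mem (hp : IsProblem f g L xstar) {γ τ : ℕ → ℝ} (hγ : ∀ k, 0 < γ k)
    (hτ0 : ∀ k, 0 < τ k) (hτ1 : ∀ k, τ k ≤ 1) {x₀ : E m} (hx₀ : x₀ ∈ effDom g)
    (K : ℕ → Finset (Fin n)) (k : ℕ) : (iter f g b γ τ x₀ K k).y ∈ effDom g := by
  induction k with
  | zero => exact hx₀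
  | succ k ih => exact hp.combo_mem (hp.prox_mem (hγ k) _) ih (hτ0 k).le (hτ1 k)

lemma lyapunov_init (γ v h : ℝ) (x₀ : E m) :
    lyapunov f g b L xstar γ v h (init f b x₀) =
      v * (realObj f g x₀ - realObj f g xstar) + 1 / 2 * ‖x₀ - xstar‖ ^ 2 := by
  have h1 : estErr f (init f b x₀) = 0 := sub_self _
  have h2 : tableErrSq f b (init f b x₀) = 0 := by
    have : ∀ i, tableErr f b (init f b x₀) i = 0 := fun i => by
      simp only [tableErr, init]
      module
    simp [tableErrSq, this]
  rw [lyapunov, h1, h2]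
  simp [init]

/-- Linear-rate decay of the expected suboptimality and distance to the minimiser, for all step
sizes and momentum parameters that make the Lyapunov function contract. -/
lemma IsProblem.pow_mul_integral_le (hp : IsProblem f g L xstar) (hb : 1 ≤ b) (hbn : b ≤ n)
    {μ : ℝ} (hg : StronglyConvex μ g) {γ τ v : ℕ → ℝ} {lam : ℝ} (hγ : ∀ k, 0 < γ k)
    (hτ0 : ∀ k, 0 < τ k) (hτ1 : ∀ k, τ k ≤ 1 / 4) (hlam : 1 ≤ lam)
    (hlamμ : ∀ k, lam ≤ 1 + μ * γ k) (hv' : ∀ k, lam * v (k + 1) ≤ γ k / τ k)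
    (hv : ∀ k, γ k / τ k * (1 - τ k) ≤ v k)
    (hγγ' : ∀ k, lam * γ (k + 1) ≤ (1 + (b : ℝ) / n / 4) * γ k)
    (hc : ∀ k, c n b * L * (γ k * τ k) ≤ 1) {x₀ : E m} (hx₀ : x₀ ∈ effDom g)
    {Ω : Type*} [MeasurableSpace Ω] {P : Measure Ω} [IsProbabilityMeasure P]
    {J : ℕ → Ω → Finset (Fin n)} (hJ : IsUniformBatches P n b J) (T : ℕ) :
    lam ^ T * ∫ ω, (v T * (realObj f g (iter f g b γ τ x₀ (fun i => J i ω) T).y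
        - realObj f g xstar)
        + 1 / 2 * ‖(iter f g b γ τ x₀ (fun i => J i ω) T).z - xstar‖ ^ 2) ∂P ≤
      v 0 * (realObj f g x₀ - realObj f g xstar) + 1 / 2 * ‖x₀ - xstar‖ ^ 2 := by
  -- Here j counts the iterations left before the fixed horizon k + j. The weight h is built
  -- backwards from 0 at the horizon, where the correlation term disappears.
  have hmain : ∀ j k, ∃ h, 0 ≤ h ∧ h ≤ 4 / 3 * γ k / ((b : ℝ) / n) ∧
      lam ^ j * ∫ ω, (v (k + j) * (realObj f g (iter f g b γ τ x₀ (fun i => J i ω) (k + j)).y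
          - realObj f g xstar)
          + 1 / 2 * ‖(iter f g b γ τ x₀ (fun i => J i ω) (k + j)).z - xstar‖ ^ 2) ∂P ≤
        ∫ ω, lyapunov f g b L xstar (γ k) (v k) h (iter f g b γ τ x₀ (fun i => J i ω) k) ∂P := by
    intro j
    induction j with
    | zero =>
      intro k
      have := hγ k
      refine ⟨0, le_rfl, by positivity, ?_⟩
      rw [pow_zero, one_mul]
      refine integral_mono (integrable_iter hJ k fun s =>
          v k * (realObj f g s.y - realObj f g xstar) + 1 / 2 * ‖s.z - xstar‖ ^ 2)
        (integrable_iter hJ k _) fun ω => ?_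
      simp only [lyapunov, mul_zero, zero_mul, sub_zero, add_assoc, add_zero]
      have hU := tableErrSq_nonneg f b (iter f g b γ τ x₀ (fun i => J i ω) k)
      gcongr
      exact le_add_of_nonneg_right (by positivity)
    | succ j ih =>
      intro k
      obtain ⟨h', hh0, hh', hle⟩ := ih (k + 1)
      have hb0 : (0 : ℝ) < b := Nat.cast_pos.2 (by omega)
      have hn : (0 : ℝ) < n := Nat.cast_pos.2 (by omega)
      have hρ1 : (b : ℝ) / n ≤ 1 := div_le_one_of_le₀ (Nat.cast_le.2 hbn) hn.le
      refine ⟨γ k + lam * (1 - (b : ℝ) / n) * h', ?_, correlation_weight_le (div_pos hb0 hn) hρ1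
        (hγ k).le hlam (hγγ' k) hh', ?_⟩
      · exact add_nonneg (hγ k).le
          (mul_nonneg (mul_nonneg (by linarith) (sub_nonneg.2 hρ1)) hh0)
      rw [show k + (j + 1) = k + 1 + j by omega, pow_succ', mul_assoc]
      refine (mul_le_mul_of_nonneg_left hle (by linarith)).trans ?_
      rw [← integral_const_mul, integral_iter_succ hbn hJ k fun s =>
        lam * lyapunov f g b L xstar (γ (k + 1)) (v (k + 1)) h' s]
      exact integral_mono (integrable_iter hJ k fun s => batchMean n b fun S =>
          lam * lyapunov f g b L xstar (γ (k + 1)) (v (k + 1)) h' (step f g b (γ k) (τ k) S s))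
        (integrable_iter hJ k _) fun ω =>
          hp.batchMean_lyapunov_le hb hbn hg (hγ k) (hγ (k + 1)).le (hτ0 k) (hτ1 k) hlam (hlamμ k)
            (hv' k) (hv k) (hγγ' k) (hc k) hh0 hh'
            (hp.iter_y_mem hγ hτ0 (fun k => (hτ1 k).trans (by norm_num)) hx₀ _ k)
  obtain ⟨h, -, -, hle⟩ := hmain T 0
  simp only [Nat.zero_add, iter] at hle
  refine hle.trans_eq ?_
  rw [lyapunov_init]
  simp

end Convergence

/-! ### Parameter choices and the two rates. -/

lemma stepSize_div_momentum {n b : ℕ} {L : ℝ} (hc : 0 < c n b) (hL : 0 < L) (k : ℕ) :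
    stepSize n b L k / momentum n b L k = ((k : ℝ) + 4 * n / b + 4) ^ 2 / (4 * (c n b * L)) := by
  have h : 0 < (k : ℝ) + 4 * n / b + 4 := by positivity
  rw [momentum, stepSize]
  field_simp
  norm_num

lemma momentum_eq {n b : ℕ} {L : ℝ} (hc : 0 < c n b) (hL : 0 < L) (k : ℕ) :
    momentum n b L k = 2 / ((k : ℝ) + 4 * n / b + 4) := by
  have h : 0 < (k : ℝ) + 4 * n / b + 4 := by positivity
  rw [momentum, stepSize]
  field_simp

end Sarge

theorem theorem6 {m n b : ℕ} (hb : 1 ≤ b) (hbn : b ≤ n)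
    (f : Fin n → Sarge.E m → ℝ) (L : ℝ≥0) (hL : 0 < L)
    (hfconv : ∀ i, ConvexOn ℝ Set.univ (f i))
    (hfdiff : ∀ i, Differentiable ℝ (f i))
    (hfLip : ∀ i, LipschitzWith L (gradient (f i)))
    (g : Sarge.E m → EReal) (hgproper : Sarge.Proper g) (hglsc : LowerSemicontinuous g)
    (hgconv : Sarge.StronglyConvex 0 g)
    (xstar : Sarge.E m) (hxstar : ∀ x, Sarge.obj f g xstar ≤ Sarge.obj f g x)
    (x₀ : Sarge.E m) (hx₀ : x₀ ∈ Sarge.effDom g)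
    {Ω : Type*} [MeasurableSpace Ω] (P : Measure Ω) [IsProbabilityMeasure P]
    (J : ℕ → Ω → Finset (Fin n)) (hJ : Sarge.IsUniformBatches P n b J) :
    -- the convex case
    (∀ T : ℕ, 1 ≤ T →
      let y : Ω → Sarge.E m := fun ω =>
        (Sarge.iter f g b (Sarge.stepSize n b L) (Sarge.momentum n b L) x₀ (fun k => J k ω) T).y
      let K₁ : ℝ := (Sarge.obj f g x₀).toReal - (Sarge.obj f g xstar).toReal
        + 2 * Sarge.c n b * L / ((4 * (n : ℝ) / b + 2) * (4 * (n : ℝ) / b + 4)) * ‖x₀ - xstar‖ ^ 2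
      (∀ᵐ ω ∂P, Sarge.obj f g (y ω) ≠ ⊤) ∧
      Integrable (fun ω => (Sarge.obj f g (y ω)).toReal) P ∧
      (∫ ω, (Sarge.obj f g (y ω)).toReal ∂P) - (Sarge.obj f g xstar).toReal ≤
        (4 * (n : ℝ) / b + 2) * (4 * (n : ℝ) / b + 4) * K₁ / ((T : ℝ) + 4 * n / b + 3) ^ 2) ∧
    -- the strongly convex case
    (∀ μ : ℝ, 0 < μ → Sarge.StronglyConvex μ g → ∀ T : ℕ,
      let z : Ω → Sarge.E m := fun ω =>
        (Sarge.iter f g b (fun _ => Sarge.stepSizeSC n b L μ) (fun _ => Sarge.momentumSC n b L μ)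
          x₀ (fun k => J k ω) T).z
      let K₂ : ℝ := 2 / μ * ((Sarge.obj f g x₀).toReal - (Sarge.obj f g xstar).toReal)
        + ‖x₀ - xstar‖ ^ 2
      Integrable (fun ω => ‖z ω - xstar‖ ^ 2) P ∧
      (∫ ω, ‖z ω - xstar‖ ^ 2 ∂P) ≤
        ((1 + min (√(μ / (L * Sarge.c n b))) ((b : ℝ) / (4 * n))) ^ T)⁻¹ * K₂) := by
  have hn : 0 < n := by omega
  have hp : Sarge.IsProblem f g L xstar :=
    ⟨hn, hL, hfconv, hfdiff, hfLip, hgproper, hglsc, hgconv, hxstar⟩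
  have hbR : (0 : ℝ) < b := Nat.cast_pos.2 (by omega)
  have hnR : (0 : ℝ) < n := Nat.cast_pos.2 hn
  have hbnR : (b : ℝ) ≤ n := Nat.cast_le.2 hbn
  have hLR : (0 : ℝ) < L := hL
  have hc : 0 < Sarge.c n b := by rw [Sarge.c]; positivity
  have htoReal : ∀ {x}, x ∈ Sarge.effDom g →
      (Sarge.obj f g x).toReal = Sarge.realObj f g x := fun hx => by
    rw [hp.obj_eq hx, EReal.toReal_coe]
  rw [htoReal hx₀, htoReal hp.xstar_mem]
  refine ⟨fun T hT => ?_, fun μ hμ hgμ T => ?_⟩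
  · obtain ⟨T, rfl⟩ := Nat.exists_eq_succ_of_ne_zero (by omega : T ≠ 0)
    intro y K₁
    set κ : ℝ := 4 * (n : ℝ) / b with hκ
    have hκ0 : 4 ≤ κ := by rw [hκ, le_div_iff₀ hbR]; linarith
    -- The offset 4n/b in the step size serves to keep its growth ratio below 1 + b/(4n).
    have hρκ : (b : ℝ) / n / 4 * κ = 1 := by rw [hκ]; field_simp
    have hs : ∀ k : ℕ, 0 < (k : ℝ) + κ + 4 := fun k => by positivity
    set γ := Sarge.stepSize n b L
    set τ := Sarge.momentum n b L
    have hτeq : ∀ k, τ k = 2 / ((k : ℝ) + κ + 4) := Sarge.momentum_eq hc hLR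
    have hquot : ∀ k, γ k / τ k = ((k : ℝ) + κ + 4) ^ 2 / (4 * (Sarge.c n b * L)) :=
      Sarge.stepSize_div_momentum hc hLR
    have hγeq : ∀ k, γ k = ((k : ℝ) + κ + 4) / (2 * Sarge.c n b * L) := fun k => rfl
    have hγ0 : ∀ k, 0 < γ k := fun k => by have := hs k; rw [hγeq]; positivity
    have hτ0 : ∀ k, 0 < τ k := fun k => by have := hs k; rw [hτeq]; positivity
    have hτ1 : ∀ k, τ k ≤ 1 / 4 := fun k => by
      rw [hτeq, div_le_iff₀ (hs k)]
      have : (0 : ℝ) ≤ k := k.cast_nonneg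
      linarith
    have hmul : ∀ k, γ k / τ k * (1 - τ k) =
        ((k : ℝ) + κ + 4) * ((k : ℝ) + κ + 2) / (4 * (Sarge.c n b * L)) := fun k => by
      have := hs k
      rw [hquot, hτeq]
      field_simp
      ring
    -- After the start, v takes the largest value that the previous step allows, which is enough
    -- because (s + 1)(s - 1) ≤ s². At 0 it takes the smallest admissible value, the source of the
    -- factor (κ + 4)(κ + 2).
    let v : ℕ → ℝ := fun k => Nat.casesOn k (γ 0 / τ 0 * (1 - τ 0)) fun k => γ k / τ k
    have hv : ∀ k, γ k / τ k * (1 - τ k) ≤ v k := fun k => by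
      cases k with
      | zero => exact le_rfl
      | succ k =>
        change _ ≤ γ k / τ k
        rw [hmul, hquot]
        refine div_le_div_of_nonneg_right ?_ (by positivity)
        push_cast
        linarith
    have hmain := hp.pow_mul_integral_le hb hbn hgconv (γ := γ) (τ := τ) (v := v) (lam := 1) hγ0
      hτ0 hτ1 le_rfl (fun k => by simp) (fun k => (one_mul _).le) hv (fun k => by
        rw [one_mul, hγeq, hγeq, ← mul_div_assoc]
        refine div_le_div_of_nonneg_right ?_ (by positivity)
        push_cast
        have : (0 : ℝ) ≤ (b : ℝ) / n / 4 * ((k : ℝ) + 4) := by positivity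
        linarith) (fun k => by
        have := hs k
        rw [hτeq, hγeq]
        refine le_of_eq ?_
        field_simp) hx₀ hJ (T + 1)
    have hmem : ∀ ω, y ω ∈ Sarge.effDom g := fun ω =>
      hp.iter_y_mem hγ0 hτ0 (fun k => (hτ1 k).trans (by norm_num)) hx₀ _ _
    have hyobj : ∀ ω, (Sarge.obj f g (y ω)).toReal = Sarge.realObj f g (y ω) := fun ω =>
      htoReal (hmem ω)
    have hint : Integrable (fun ω => Sarge.realObj f g (y ω)) P :=
      Sarge.integrable_iter hJ (T + 1) fun s => Sarge.realObj f g s.y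
    simp only [hyobj]
    refine ⟨.of_forall fun ω => Sarge.obj_ne_top_iff.2 (hmem ω), hint, ?_⟩
    have hle : v (T + 1) * ((∫ ω, Sarge.realObj f g (y ω) ∂P) - Sarge.realObj f g xstar) ≤
        v 0 * (Sarge.realObj f g x₀ - Sarge.realObj f g xstar) + 1 / 2 * ‖x₀ - xstar‖ ^ 2 := by
      rw [one_pow, one_mul] at hmain
      refine le_trans ?_ hmain
      have h1 : v (T + 1) * ((∫ ω, Sarge.realObj f g (y ω) ∂P) - Sarge.realObj f g xstar) =
          ∫ ω, v (T + 1) * (Sarge.realObj f g (y ω) - Sarge.realObj f g xstar) ∂P := by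
        rw [integral_const_mul, integral_sub hint (integrable_const _), integral_const]
        simp
      rw [h1]
      refine integral_mono ((hint.sub (integrable_const _)).const_mul _)
        (Sarge.integrable_iter hJ (T + 1) fun s =>
          v (T + 1) * (Sarge.realObj f g s.y - Sarge.realObj f g xstar)
            + 1 / 2 * ‖s.z - xstar‖ ^ 2) fun ω => ?_
      exact le_add_of_nonneg_right (by positivity)
    have hvT : v (T + 1) = ((T : ℝ) + κ + 4) ^ 2 / (4 * (Sarge.c n b * L)) := hquot T
    have hv0 : v 0 = (κ + 4) * (κ + 2) / (4 * (Sarge.c n b * L)) := by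
      have h := hmul 0
      rw [Nat.cast_zero, zero_add] at h
      exact h
    rw [hvT, hv0] at hle
    have hcast : ((T + 1 : ℕ) : ℝ) + κ + 3 = (T : ℝ) + κ + 4 := by push_cast; ring
    change _ ≤ (κ + 2) * (κ + 4) * K₁ / (((T + 1 : ℕ) : ℝ) + κ + 3) ^ 2
    rw [hcast, le_div_iff₀ (pow_pos (hs T) 2)]
    have hK : (κ + 2) * (κ + 4) * K₁ = (κ + 4) * (κ + 2) *
        (Sarge.realObj f g x₀ - Sarge.realObj f g xstar)
        + 2 * Sarge.c n b * L * ‖x₀ - xstar‖ ^ 2 := by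
      simp only [K₁, ← hκ]
      have h2 : 0 < κ + 2 := by linarith
      have h4 : 0 < κ + 4 := by linarith
      field_simp
    rw [hK]
    have hD : 0 < 4 * (Sarge.c n b * L) := by positivity
    have h := mul_le_mul_of_nonneg_left hle hD.le
    have e1 : 4 * (Sarge.c n b * L) * (((T : ℝ) + κ + 4) ^ 2 / (4 * (Sarge.c n b * L)) *
        ((∫ ω, Sarge.realObj f g (y ω) ∂P) - Sarge.realObj f g xstar)) =
        ((∫ ω, Sarge.realObj f g (y ω) ∂P) - Sarge.realObj f g xstar) *
          ((T : ℝ) + κ + 4) ^ 2 := by field_simp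
    have e2 : 4 * (Sarge.c n b * L) * ((κ + 4) * (κ + 2) / (4 * (Sarge.c n b * L)) *
        (Sarge.realObj f g x₀ - Sarge.realObj f g xstar) + 1 / 2 * ‖x₀ - xstar‖ ^ 2) =
        (κ + 4) * (κ + 2) * (Sarge.realObj f g x₀ - Sarge.realObj f g xstar)
        + 2 * Sarge.c n b * L * ‖x₀ - xstar‖ ^ 2 := by field_simp; ring
    rwa [e1, e2] at h
  · intro z K₂
    set γ := Sarge.stepSizeSC n b L μ with hγ
    have hγ0 : 0 < γ := lt_min (by positivity) (by positivity)
    have hlam : μ * γ = min (√(μ / (L * Sarge.c n b))) ((b : ℝ) / (4 * n)) := by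
      rw [hγ, Sarge.stepSizeSC, mul_min_of_nonneg _ _ hμ.le]
      congr 1
      · rw [show Sarge.c n b * μ * L = L * Sarge.c n b * μ by ring, Real.sqrt_div hμ.le,
          Real.sqrt_mul (by positivity : 0 ≤ (L : ℝ) * Sarge.c n b)]
        have h1 : 0 < √μ := Real.sqrt_pos.2 hμ
        have h2 : 0 < √(L * Sarge.c n b) := Real.sqrt_pos.2 (by positivity)
        field_simp
        rw [Real.sq_sqrt hμ.le]
      · field_simp
    have hτρ : μ * γ ≤ (b : ℝ) / n / 4 := by
      rw [hlam]
      refine (min_le_right _ _).trans_eq ?_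
      field_simp
    have hρ1 : (b : ℝ) / n ≤ 1 := div_le_one_of_le₀ hbnR hnR.le
    have hτ0 : 0 < μ * γ := by positivity
    have hquot : γ / (μ * γ) = 1 / μ := by field_simp
    have hcγ : Sarge.c n b * L * (γ * (μ * γ)) ≤ 1 := by
      have hpos : 0 < Sarge.c n b * μ * L := by positivity
      have h1 : γ ^ 2 ≤ (1 / √(Sarge.c n b * μ * L)) ^ 2 :=
        pow_le_pow_left₀ hγ0.le (min_le_left _ _) 2
      rw [div_pow, one_pow, Real.sq_sqrt hpos.le, le_div_iff₀ hpos] at h1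
      linarith
    -- With τ = μγ, the choice of v makes λv = γ/τ exact, and (1 - τ)(1 + τ) ≤ 1 gives the other
    -- bound. The two terms of the minimum defining γ give cLγτ ≤ 1 and λ ≤ 1 + b/(4n).
    have hmain := hp.pow_mul_integral_le hb hbn hgμ (γ := fun _ => γ) (τ := fun _ => μ * γ)
      (v := fun _ => 1 / μ / (1 + μ * γ)) (lam := 1 + μ * γ) (fun _ => hγ0) (fun _ => hτ0)
      (fun _ => by linarith) (by linarith) (fun _ => le_rfl)
      (fun _ => by rw [hquot]; refine le_of_eq ?_; field_simp)
      (fun _ => by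
        rw [hquot, le_div_iff₀ (by linarith), mul_assoc]
        exact mul_le_of_le_one_right (by positivity) (by linarith [sq_nonneg (μ * γ)]))
      (fun _ => mul_le_mul_of_nonneg_right (by linarith) hγ0.le) (fun _ => hcγ) hx₀ hJ T
    have hint : Integrable (fun ω => ‖z ω - xstar‖ ^ 2) P :=
      Sarge.integrable_iter hJ T fun s => ‖s.z - xstar‖ ^ 2
    refine ⟨hint, ?_⟩
    have hΔ := sub_nonneg.2 (hp.realObj_le hx₀)
    have hpow : 0 < (1 + μ * γ) ^ T := by positivity
    have hle : (1 + μ * γ) ^ T * (1 / 2 * ∫ ω, ‖z ω - xstar‖ ^ 2 ∂P) ≤ 1 / 2 * K₂ := by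
      refine le_trans (mul_le_mul_of_nonneg_left ?_ hpow.le) (hmain.trans ?_)
      · rw [← integral_const_mul]
        refine integral_mono (hint.const_mul _)
          (Sarge.integrable_iter hJ T fun s =>
            1 / μ / (1 + μ * γ) * (Sarge.realObj f g s.y - Sarge.realObj f g xstar)
              + 1 / 2 * ‖s.z - xstar‖ ^ 2) fun ω => ?_
        refine le_add_of_nonneg_left (mul_nonneg (by positivity) (sub_nonneg.2 ?_))
        exact hp.realObj_le (hp.iter_y_mem (fun _ => hγ0) (fun _ => hτ0)
          (fun _ => by linarith) hx₀ _ _)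
      · have h1 : 1 / μ / (1 + μ * γ) ≤ 1 / μ := div_le_self (by positivity) (by linarith)
        have h2 := mul_le_mul_of_nonneg_right h1 hΔ
        have h3 : K₂ = 2 * (1 / μ * (Sarge.realObj f g x₀ - Sarge.realObj f g xstar))
          + ‖x₀ - xstar‖ ^ 2 := by simp only [K₂]; ring
        rw [h3]
        linarith
    rw [← hlam, inv_mul_eq_div, le_div_iff₀ hpow]
    linarith
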